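/- Let $G$ be a finite-dimensional real Lie group and $\mathfrak g=T_1G$, with basis $t^a$. Let $\gamma^a$ be the right-invariant vector field with $\gamma^a(1)=t^a$, let $f^{ab}_c$ be defined by $[\gamma^a,\gamma^b]=f^{ab}_c\gamma^c$, let $x^a=\langle x,t^a\rangle$ be the coordinates on $\mathfrak g^*$, $\partial_i$ the corresponding coordinate vector fields, and $\Theta^{ij}(x)=f^{ij}_kx^k$. On the groupoid $\mathfrak g^*\times G\rightrightarrows\mathfrak g^*$ with source $\mathsf s(x,g)=x$, target $\mathsf t(x,g)=g^{-1}xg$ (that is, $\langle g^{-1}xg,\xi\rangle=\langle x,g\xi g^{-1}\rangle$) and product $(g^{-1}xg,h)\circ(x,g)=(x,gh)$, take the two-form $\omega=-d\vartheta$, $\vartheta(x,g)=\langle x,dg\,g^{-1}\rangle$. For a nondegenerate two-form $\Omega$, the bracket is $\{u,v\}=\partial_Iu\,(\Omega^{-1})^{IJ}\,\partial_Jv$, where $\Omega_{IJ}=\Omega(\partial_I,\partial_J)$. Let $\Sigma$ be a bisection, $\Sigma_s(x)=(x,\mathcal A(x))$ with $\mathcal A:\mathfrak g^*\to G$ smooth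 and $l_\Sigma=\mathsf t\circ\Sigma_s=r_{\Sigma^{-1}}$ a diffeomorphism of $\mathfrak g^*$. Put $r_\Sigma=l_\Sigma^{-1}$, $\Sigma_t=\Sigma_s\circ r_\Sigma$, $F^s=\Sigma_s^*\omega$, $F^t=\Sigma_t^*\omega$, $R_\Sigma(y,h)=(r_\Sigma(y),\mathcal A(r_\Sigma(y))\,h)$ and $\omega_h=R_\Sigma^*\omega$. Two-forms on $\mathfrak g^*$ are identified with their component matrices $F_{ij}=F(\partial_i,\partial_j)$. Let $\log$ be a smooth local inverse near $1\in G$ of the exponential map, let $\pi_a$ be the coordinates $h=\exp(t^a\pi_a)$ near $1$, and let the gauge-invariant momenta be the functions $\pi_a(x,g)$ given by the coordinates of $h=\mathcal A(x)^{-1}g$. Then: 1. $\omega$ and $\omega_h$ are nondegenerate everywhere, and $\omega_h=-d\langle y,dh\,h^{-1}\rangle+F^t$ (with $F^t$ pulled back along $(y,h)\mapsto y$). 2. For every $y\in\mathfrak g^*$, let $\widehat{\mathcal F}_{ab}(y)$ be the bracket, with respect to $\omega_h$, of the coordinate functions $\pi_a,\pi_b$ of $h$, at the point $(y,1)$. Then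 $\mathbb I+F^t(y)\Theta(y)$ is invertible and $$\widehat{\mathcal F}(y)=\big[\mathbb I+F^t(y)\Theta(y)\big]^{-1}F^t(y).$$ 3. For every $x\in\mathfrak g^*$ the matrices $J_i^j=\partial_i\, r_{\Sigma^{-1}}^j(x)$ (row $i$, column $j$) and $\mathbb I+\bar JF^s\bar J^T\Theta(r_{\Sigma^{-1}}(x))$, $\bar J=J^{-1}$, are invertible, and the brackets with respect to $\omega$ of the gauge-invariant momenta at the point $(x,\mathcal A(x))$ satisfy $$\{\pi_a,\pi_b\}\big|_{(x,\mathcal A(x))}=\widehat{\mathcal F}_{ab}(r_{\Sigma^{-1}}(x))=\Big[\big(\mathbb I+\bar JF^s\bar J^T\,\Theta(r_{\Sigma^{-1}}(x))\big)^{-1}\bar JF^s\bar J^T\Big]_{ab}(x).$$ 4. Suppose $\mathcal A(x)=\exp(t^aA_a(x))$ for all $x$, with $A:\mathfrak g^*\to\mathfrak g$ smooth, and let $g(p)=\exp(t^ip_i)$. Let $\rho_a^m(p)$ be the matrix of the left-invariant forms, $g^{-1}dg=t^a\rho_a^m\,dp_m$, let $\bar\gamma_a^i(p)$ be given by $dg\,g^{-1}=t^a\bar\gamma_a^i\,dp_i$,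 and where $\bar\gamma(p)$ is invertible let $\gamma^a_i(p)$ be the inverse matrix, $\gamma^a_i\bar\gamma^i_b=\delta^a_b$. At every $x$ where $\bar\gamma(A(x))$ is invertible, put $F_{mn}=\gamma^l_m(A)\,\partial_lA_n-\gamma^l_n(A)\,\partial_lA_m+\Theta^{ij}\,\partial_iA_m\,\partial_jA_n$ and $\mathcal F=\rho(A)^TF\rho(A)$, i.e. $\mathcal F_{ab}=\rho_a^m(A)\rho_b^n(A)F_{mn}$. Then $\mathcal F_{ab}(x)=\{\pi_a,\pi_b\}|_{(x,\mathcal A(x))}$ is the bracket of the gauge-invariant momenta at $p=A(x)$, $\mathcal F(x)=\widehat{\mathcal F}(r_{\Sigma^{-1}}(x))$, and $$\mathcal F(x)=\big(\mathbb I+\bar JF^s\bar J^T\,\Theta(r_{\Sigma^{-1}}(x))\big)^{-1}\bar JF^s\bar J^T.$$ -/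

import Mathlib

open scoped Manifold ContDiff Topology

noncomputable section

namespace PoissonGauge

/-! ### Differential forms, pull-back, exterior derivative and Poisson bracket on a manifold -/

section Forms

/-- Differential `k`-forms on `M` (no regularity imposed). -/
abbrev DiffForm {E : Type*} [NormedAddCommGroup E] [NormedSpace ℝ E] {H : Type*}
    [TopologicalSpace H] (I : ModelWithCorners ℝ E H) (M : Type*) [TopologicalSpace M]
    [ChartedSpace H M] (k : ℕ) : Type _ :=
  (p : M) → TangentSpace I p [⋀^Fin k]→L[ℝ] ℝ

variable {E : Type*} [NormedAddCommGroup E] [NormedSpace ℝ E] {H : Type*} [TopologicalSpace H]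
  (I : ModelWithCorners ℝ E H) {M : Type*} [TopologicalSpace M] [ChartedSpace H M]
  {E' : Type*} [NormedAddCommGroup E'] [NormedSpace ℝ E'] {H' : Type*} [TopologicalSpace H']
  (I' : ModelWithCorners ℝ E' H') {M' : Type*} [TopologicalSpace M'] [ChartedSpace H' M']

/-- The pull-back `f^* α` of a form along `f : M → M'`. -/
def pullback {k : ℕ} (f : M → M') (α : DiffForm I' M' k) : DiffForm I M k := fun p =>
  (α (f p)).compContinuousLinearMap (mfderiv I I' f p)

/-- The coordinate expression of a form in the preferred chart at `p`. -/
def chartRep {k : ℕ} (α : DiffForm I M k) (p : M) : E → E [⋀^Fin k]→L[ℝ] ℝ := fun e =>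
  (α ((extChartAt I p).symm e)).compContinuousLinearMap
    (mfderivWithin 𝓘(ℝ, E) I (extChartAt I p).symm (Set.range I) e)

/-- The exterior derivative on a manifold: at `p` it is the exterior derivative of the coordinate
expression in the chart at `p`, transported back to `M` by that chart
(no factor `1/2`: `dα(X, Y) = X(α(Y)) - Y(α(X)) - α([X, Y])` for a one-form). -/
def extD {k : ℕ} (α : DiffForm I M k) : DiffForm I M (k + 1) := fun p =>
  (extDerivWithin (chartRep I α p) (Set.range I) (extChartAt I p p)).compContinuousLinearMap
    (mfderiv I 𝓘(ℝ, E) (extChartAt I p) p)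

/-- The two-form `ω` is nondegenerate at `p`: every covector at `p` is `ω(v, ·)` for exactly
one tangent vector `v`. -/
def NondegenerateAt (Om : DiffForm I M 2) (p : M) : Prop :=
  ∀ α : TangentSpace I p →L[ℝ] ℝ, ∃! v : TangentSpace I p, ∀ w, Om p ![v, w] = α w

/-- The vector `v` with `ω(v, ·) = α` (meaningful where `ω` is nondegenerate). -/
def sharp (Om : DiffForm I M 2) (p : M) (α : TangentSpace I p →L[ℝ] ℝ) : TangentSpace I p :=
  Classical.epsilon fun v => ∀ w, Om p ![v, w] = α w

/-- The Poisson bracket `{f, g} = dg(X_f)`, `ω(X_f, ·) = df`. In coordinates this is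
`{f, g} = ∂_I f (Ω⁻¹)^{IJ} ∂_J g` with `Ω_{IJ} = ω(∂_I, ∂_J)`; for `ω = dp_i ∧ dx^i` it gives
`{x^i, p_j} = δ^i_j`. -/
def poissonBracket (Om : DiffForm I M 2) (f g : M → ℝ) (p : M) : ℝ :=
  mfderiv I 𝓘(ℝ, ℝ) g p (sharp I Om p (mfderiv I 𝓘(ℝ, ℝ) f p))

end Forms

/-! ### Lie groups: invariant forms and fields, exponential map

`G` is a Lie group modelled on `E`; in Mathlib the Lie algebra `𝔤 = T_1 G` has the vector space
`E` as underlying space, and `𝔤^*` is `StrongDual ℝ E`. -/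

section Group

variable {E : Type*} [NormedAddCommGroup E] [NormedSpace ℝ E]
  {G : Type*} [TopologicalSpace G] [ChartedSpace E G] [Group G]

/-- The right-invariant form `dg g⁻¹` with values in `𝔤`. -/
def rightMC (g : G) : TangentSpace 𝓘(ℝ, E) g →L[ℝ] E :=
  mfderiv 𝓘(ℝ, E) 𝓘(ℝ, E) (fun k : G => k * g⁻¹) g

/-- The left-invariant form `g⁻¹ dg` with values in `𝔤`. -/
def leftMC (g : G) : TangentSpace 𝓘(ℝ, E) g →L[ℝ] E :=
  mfderiv 𝓘(ℝ, E) 𝓘(ℝ, E) (fun k : G => g⁻¹ * k) g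

/-- The right-invariant vector field on `G` with value `v` at the identity. -/
def rightField (v : E) (g : G) : TangentSpace 𝓘(ℝ, E) g :=
  (mfderiv 𝓘(ℝ, E) 𝓘(ℝ, E) (fun k : G => k * g) 1 : E →L[ℝ] E) v

/-- The adjoint action `Ad_g ξ = g ξ g⁻¹`. -/
def Ad (g : G) : E →L[ℝ] E :=
  mfderiv 𝓘(ℝ, E) 𝓘(ℝ, E) (fun k : G => g * k * g⁻¹) 1

variable (G) in
/-- The exponential map: `exp ξ = c(1)` for the integral curve `c` of the left-invariant vector
field of `ξ` with `c(0) = 1`. -/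
def lieExp (ξ : E) : G :=
  Classical.epsilon (fun c : ℝ → G => c 0 = 1 ∧
    IsMIntegralCurve (I := 𝓘(ℝ, E)) c
      (fun g => mulInvariantVectorField (I := 𝓘(ℝ, E)) (G := G) ξ g)) 1

/-- `lg` is a logarithm of `G` near the identity, i.e. a smooth local inverse of `exp` at `0`;
its components are the canonical coordinates `π_a`, `h = exp(t^a π_a)`. -/
structure IsLieLog (lg : G → E) : Prop where
  contMDiffAt : ContMDiffAt 𝓘(ℝ, E) 𝓘(ℝ, E) ∞ lg 1
  log_exp : ∀ᶠ ξ in 𝓝 (0 : E), lg (lieExp G ξ) = ξ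
  exp_log : ∀ᶠ h in 𝓝 (1 : G), lieExp G (lg h) = h

variable {ι : Type*} [Fintype ι] (t : Module.Basis ι ℝ E)

variable (G) in
/-- The structure constants `f^{ab}_c`, defined by `[γ^a, γ^b] = f^{ab}_c γ^c`, where `γ^a` is the
right-invariant vector field with `γ^a(1) = t^a` (the bracket of `𝔤` is the one of right-invariant
vector fields). -/
def structConst (a b c : ι) : ℝ :=
  t.repr (VectorField.mlieBracket 𝓘(ℝ, E)
    (rightField (G := G) (t a)) (rightField (G := G) (t b)) (1 : G) : E) c

variable (G) in
/-- `Θ^{ab}(x) = f^{ab}_c x^c`, with coordinates `x^c = ⟨x, t^c⟩` on `𝔤^*`. -/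
def Theta (x : StrongDual ℝ E) : Matrix ι ι ℝ :=
  Matrix.of fun a b => ∑ c, structConst G t a b c * x (t c)

variable (G) in
/-- The matrix of `dg g⁻¹ = t^a γ̄_a^i(p) dp_i` in the coordinates `g(p) = exp(t^i p_i)`;
row `i`, column `a`. -/
def gammaBar (p : E) : Matrix ι ι ℝ :=
  Matrix.of fun i a => t.repr (rightMC (lieExp G p)
    (mfderiv 𝓘(ℝ, E) 𝓘(ℝ, E) (lieExp G) p (t i))) a

variable (G) in
/-- The matrix `γ^a_i(p)` of the right-invariant vector fields `γ^a = γ^a_i ∂^i_p`, dual to the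
forms `γ̄_a`; row `a`, column `i`. -/
def gamma [DecidableEq ι] (p : E) : Matrix ι ι ℝ := (gammaBar G t p)⁻¹

variable (G) in
/-- The matrix of the left-invariant forms, `g⁻¹ dg = t^a ρ_a^m(p) dp_m`; row `m`, column `a`. -/
def rho (p : E) : Matrix ι ι ℝ :=
  Matrix.of fun m a => t.repr (leftMC (lieExp G p)
    (mfderiv 𝓘(ℝ, E) 𝓘(ℝ, E) (lieExp G) p (t m))) a

end Group

/-! ### The symplectic groupoid `𝔤^* × G ⇉ 𝔤^*`, its bisections and the field strengths -/

section Groupoid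

variable {E : Type*} [NormedAddCommGroup E] [NormedSpace ℝ E] [FiniteDimensional ℝ E]
  {G : Type*} [TopologicalSpace G] [ChartedSpace E G] [Group G]

variable (E G) in
/-- The groupoid `𝔤^* × G`. -/
abbrev Gpd : Type _ := StrongDual ℝ E × G

variable (E) in
/-- The model of `𝔤^*`. -/
abbrev modelX : ModelWithCorners ℝ (StrongDual ℝ E) (StrongDual ℝ E) := 𝓘(ℝ, StrongDual ℝ E)

variable (E) in
/-- The model of `𝔤^* × G`. -/
abbrev modelGpd : ModelWithCorners ℝ (StrongDual ℝ E × E) (ModelProd (StrongDual ℝ E) E) :=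
  (modelX E).prod 𝓘(ℝ, E)

/-- The source map `s(x, g) = x`. -/
def source (q : Gpd E G) : StrongDual ℝ E := q.1

/-- The target map `t(x, g) = g⁻¹ x g`, i.e. `⟨g⁻¹ x g, ξ⟩ = ⟨x, g ξ g⁻¹⟩`. -/
def target (q : Gpd E G) : StrongDual ℝ E := q.1.comp (Ad q.2)

/-- The product `β ∘ α = (x, g · h)` of `α = (x, g)` and `β = (g⁻¹ x g, h)`. -/
def gpdMul (β α : Gpd E G) : Gpd E G := (α.1, α.2 * β.2)

/-- The Liouville form `ϑ(x, g) = ⟨x, dg g⁻¹⟩`. -/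
def liouville : DiffForm (modelGpd E) (Gpd E G) 1 := fun q =>
  ContinuousAlternatingMap.ofSubsingleton ℝ (TangentSpace (modelGpd E) q) ℝ (0 : Fin 1)
    ((q.1 : E →L[ℝ] ℝ).comp ((rightMC q.2).comp
      (mfderiv (modelGpd E) 𝓘(ℝ, E) (Prod.snd : Gpd E G → G) q)))

/-- The symplectic form `ω = -dϑ`. -/
def omega : DiffForm (modelGpd E) (Gpd E G) 2 := fun q => -(extD (modelGpd E) liouville q)

variable (E G) in
/-- A bisection, given by the section `Σ_s = (s|_Σ)⁻¹` of the source map; `l_Σ = t ∘ Σ_s` has to be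
a diffeomorphism of the base. -/
structure Bisection where
  /-- the section `Σ_s : 𝔤^* → 𝔤^* × G` of the source map -/
  sec : StrongDual ℝ E → Gpd E G
  contMDiff_sec : ContMDiff (modelX E) (modelGpd E) ∞ sec
  source_sec : ∀ x, source (sec x) = x
  /-- the diffeomorphism `l_Σ = t ∘ Σ_s = r_{Σ⁻¹}` of the base -/
  l : StrongDual ℝ E ≃ₘ⟮modelX E, modelX E⟯ StrongDual ℝ E
  target_sec : ∀ x, target (sec x) = l x

namespace Bisection

variable (S : Bisection E G)

/-- The `G`-component `𝒜` of the bisection: `Σ_s(x) = (x, 𝒜(x))`. -/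
def val (x : StrongDual ℝ E) : G := (S.sec x).2

/-- `r_Σ = l_Σ⁻¹`. -/
def r : StrongDual ℝ E → StrongDual ℝ E := S.l.symm

/-- `Σ_t = (t|_Σ)⁻¹ = Σ_s ∘ r_Σ`. -/
def secT (y : StrongDual ℝ E) : Gpd E G := S.sec (S.r y)

/-- The right action `R_Σ(y, h) = (y, h) ∘ Σ_t(y) = (r_Σ(y), 𝒜(r_Σ(y)) · h)`. -/
def R (q : Gpd E G) : Gpd E G := gpdMul q (S.secT q.1)

/-- The covariant field strength `F^s = Σ_s^* ω`. -/
def Fs : DiffForm (modelX E) (StrongDual ℝ E) 2 := pullback (modelX E) (modelGpd E) S.sec omega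

/-- The invariant field strength `F^t = Σ_t^* ω`. -/
def Ft : DiffForm (modelX E) (StrongDual ℝ E) 2 := pullback (modelX E) (modelGpd E) S.secT omega

/-- `ω_h = R_Σ^* ω`. -/
def omegaH : DiffForm (modelGpd E) (Gpd E G) 2 := pullback (modelGpd E) (modelGpd E) S.R omega

end Bisection

variable {ι : Type*} [Fintype ι] (t : Module.Basis ι ℝ E)

/-- The coordinate vector `∂_i` on `𝔤^*`: the element `t^*_i` of the dual basis. -/
def dualVec (i : ι) : StrongDual ℝ E := LinearMap.toContinuousLinearMap (t.coord i)

/-- The component matrix `F_{ij}(x) = F(∂_i, ∂_j)(x)` of a two-form on `𝔤^*`. -/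
def formMatrix (F : DiffForm (modelX E) (StrongDual ℝ E) 2) (x : StrongDual ℝ E) : Matrix ι ι ℝ :=
  Matrix.of fun i j =>
    (F x : StrongDual ℝ E [⋀^Fin 2]→L[ℝ] ℝ) ![dualVec t i, dualVec t j]

/-- `𝓕̂_{ab}(y) = {π_a, π_b}_A` at `π = 0`: the bracket of the coordinates `π_a` of
`h = exp(t^a π_a)` with respect to `ω_h`, at the point `(y, 1)`. -/
def FHat (S : Bisection E G) (lg : G → E) (y : StrongDual ℝ E) : Matrix ι ι ℝ :=
  Matrix.of fun a b => poissonBracket (modelGpd E) S.omegaH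
    (fun q => t.repr (lg q.2) a) (fun q => t.repr (lg q.2) b) (y, 1)

/-- The gauge-invariant momenta `π_a(x, g)`, i.e. the coordinates of `h = 𝒜(x)⁻¹ · g`. -/
def momentum (S : Bisection E G) (lg : G → E) (a : ι) (q : Gpd E G) : ℝ :=
  t.repr (lg ((S.val q.1)⁻¹ * q.2)) a

/-- The brackets `{π_a, π_b}` of the gauge-invariant momenta with respect to `ω`, on the
bisection, i.e. at `(x, g) = (x, 𝒜(x))`. -/
def momentumBracket (S : Bisection E G) (lg : G → E) (x : StrongDual ℝ E) : Matrix ι ι ℝ :=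
  Matrix.of fun a b => poissonBracket (modelGpd E) omega
    (momentum t S lg a) (momentum t S lg b) (S.sec x)

/-- The Jacobian matrix `J_i^j(x) = ∂_i r^j_{Σ⁻¹}(x)`; row `i`, column `j`. -/
def jac (S : Bisection E G) (x : StrongDual ℝ E) : Matrix ι ι ℝ :=
  Matrix.of fun i j => (fderiv ℝ S.l x (dualVec t i)) (t j)

/-- The matrix `J̄ F^s J̄^T` at `x`, with `J̄ = J⁻¹`. -/
def FsBar [DecidableEq ι] (S : Bisection E G) (x : StrongDual ℝ E) : Matrix ι ι ℝ :=
  (jac t S x)⁻¹ * formMatrix t S.Fs x * ((jac t S x)⁻¹).transpose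

/-- `∂_l A_m(x)`; row `l`, column `m`. -/
def dA (A : StrongDual ℝ E → E) (x : StrongDual ℝ E) : Matrix ι ι ℝ :=
  Matrix.of fun l m => t.repr (fderiv ℝ A x (dualVec t l)) m

variable (G) in
/-- `F_{mn}(x) = γ^l_m(A) ∂_l A_n - γ^l_n(A) ∂_l A_m + {A_m, A_n}`, where
`{A_m, A_n} = Θ^{ij} ∂_i A_m ∂_j A_n`. -/
def FNaive [DecidableEq ι] (A : StrongDual ℝ E → E) (x : StrongDual ℝ E) : Matrix ι ι ℝ :=
  Matrix.of fun m n =>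
    (∑ l, gamma G t (A x) l m * dA t A x l n) - (∑ l, gamma G t (A x) l n * dA t A x l m)
      + ∑ i, ∑ j, Theta G t x i j * dA t A x i m * dA t A x j n

variable (G) in
/-- `𝓕 = ρ(A)^T F ρ(A)`, i.e. `𝓕_{ab} = ρ_a^m(A) ρ_b^n(A) F_{mn}`. -/
def FCal [DecidableEq ι] (A : StrongDual ℝ E → E) (x : StrongDual ℝ E) : Matrix ι ι ℝ :=
  (rho G t (A x)).transpose * FNaive G t A x * rho G t (A x)

end Groupoid

end PoissonGauge

end

open PoissonGauge

set_option linter.unusedSectionVars false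

/-! Trivialize the tangent bundle of $\mathfrak g^*\times G$ by the right-invariant form
$dg\,g^{-1}$. The Maurer–Cartan equation (`exists_hasFDerivAt_rMCChart`), with the bracket of
right-invariant fields, gives $\omega((p,\xi),(p',\xi'))=p'(\xi)-p(\xi')+x([\xi,\xi'])$
(`omega_eq`), and nondegeneracy can be read off.

In this frame $R_\Sigma$ has differential $(v,\xi)\mapsto(dr_\Sigma v,\ a(v)+\mathrm{Ad}\,\xi)$,
where $a$ is the right-trivialized derivative of $\mathcal A\circ r_\Sigma$ and $\mathrm{Ad}$ is
taken at $\mathcal A(r_\Sigma(y))$. Differentiating $r_\Sigma(y)\circ\mathrm{Ad}=y$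
(`Bisection.apply_eq`) shows that the terms of $R_\Sigma^*\omega$ mixing $v$ and $\xi$ are those of
$\omega$ itself; `Ad_bracket` deals with the terms in $\xi,\xi'$, and the terms in $v,v'$ are $F^t$.
Hence $\omega_h=\omega+F^t$ (`Bisection.omegaH_eq`).

At $h=1$ the logarithm has derivative the identity, so the Hamiltonian vector of $\pi_a$ solves a
linear system. Eliminating its $\mathfrak g^*$-component leaves $\Phi+\Phi\Theta F^t=F^t$ for
$\Phi=\widehat{\mathcal F}$ (`FHat_equation`). This factors as $(1-\Phi\Theta)(1+F^t\Theta)=1$,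
which yields the invertibility and the formula together.

The map $R_\Sigma$ carries $\omega_h$ to $\omega$, the point $(l_\Sigma(x),1)$ to $\Sigma_s(x)$, and
pulls the gauge-invariant momenta back to the coordinates of $h$ (`momentumBracket_eq_FHat`). Since
$\Sigma_t=\Sigma_s\circ r_\Sigma$, the matrix of $F^t$ at $l_\Sigma(x)$ is $\bar JF^s\bar J^T$
(`formMatrix_Ft`). The formula with $\rho$ and $\gamma$ is checked independently of $\omega_h$, by
writing down the Hamiltonian vectors of the momenta for $\omega$ on the bisection
(`FCal_eq_momentumBracket`). -/

noncomputable section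

namespace PoissonGauge

/-! ### Derivatives with values in the fixed model spaces -/

section ModelDeriv

variable {E : Type*} [NormedAddCommGroup E] [NormedSpace ℝ E] {H : Type*} [TopologicalSpace H]
  {I : ModelWithCorners ℝ E H} {M : Type*} [TopologicalSpace M] [ChartedSpace H M]
  {E' : Type*} [NormedAddCommGroup E'] [NormedSpace ℝ E'] {H' : Type*} [TopologicalSpace H']
  {I' : ModelWithCorners ℝ E' H'} {M' : Type*} [TopologicalSpace M'] [ChartedSpace H' M']
  {E'' : Type*} [NormedAddCommGroup E''] [NormedSpace ℝ E''] {H'' : Type*} [TopologicalSpace H'']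
  {I'' : ModelWithCorners ℝ E'' H''} {M'' : Type*} [TopologicalSpace M''] [ChartedSpace H'' M'']

variable (I I') in
/-- The manifold derivative, with the tangent spaces replaced by the model vector spaces. -/
def modelDeriv (f : M → M') (p : M) : E →L[ℝ] E' := mfderiv I I' f p

/-- The separate base point `y` allows a simplified form of `f p`, such as `1` for `g * g⁻¹`,
without transport between tangent spaces. -/
theorem modelDeriv_comp {g : M' → M''} {f : M → M'} {p : M} {y : M'}
    (hg : MDifferentiableAt I' I'' g y) (hf : MDifferentiableAt I I' f p) (hy : f p = y) :
    modelDeriv I I'' (fun z => g (f z)) p = (modelDeriv I' I'' g y).comp (modelDeriv I I' f p) := by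
  subst hy
  exact mfderiv_comp p hg hf

theorem modelDeriv_prodMk {f : M → M'} {g : M → M''} {p : M}
    (hf : MDifferentiableAt I I' f p) (hg : MDifferentiableAt I I'' g p) :
    modelDeriv I (I'.prod I'') (fun z => (f z, g z)) p =
      (modelDeriv I I' f p).prod (modelDeriv I I'' g p) :=
  mfderiv_prodMk hf hg

theorem modelDeriv_id (p : M) : modelDeriv I I (fun z : M => z) p = ContinuousLinearMap.id ℝ E :=
  mfderiv_id

theorem modelDeriv_fst (p : M × M') :
    modelDeriv (I.prod I') I (fun z : M × M' => z.1) p = ContinuousLinearMap.fst ℝ E E' :=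
  mfderiv_fst

theorem modelDeriv_snd (p : M × M') :
    modelDeriv (I.prod I') I' (fun z : M × M' => z.2) p = ContinuousLinearMap.snd ℝ E E' :=
  mfderiv_snd

theorem modelDeriv_eq_fderiv (f : E → E') (p : E) :
    modelDeriv 𝓘(ℝ, E) 𝓘(ℝ, E') f p = fderiv ℝ f p :=
  mfderiv_eq_fderiv

theorem modelDeriv_congr {f g : M → M'} {p : M} (h : f =ᶠ[𝓝 p] g) :
    modelDeriv I I' f p = modelDeriv I I' g p := by
  have h0 : f p = g p := h.self_of_nhds
  unfold modelDeriv
  exact h.mfderiv_eq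

theorem modelDeriv_prod_apply {f : M × M' → M''} {p : M × M'}
    (hf : MDifferentiableAt (I.prod I') I'' f p) (v : E × E') :
    modelDeriv (I.prod I') I'' f p v =
      modelDeriv I I'' (fun z => f (z, p.2)) p.1 v.1 +
        modelDeriv I' I'' (fun z => f (p.1, z)) p.2 v.2 :=
  mfderiv_prod_eq_add_apply hf

/-- The value of a two-form at a point, on the model vector space. -/
def formAt (Om : DiffForm I M 2) (p : M) : E [⋀^Fin 2]→L[ℝ] ℝ := Om p

end ModelDeriv

/-! ### Translations, the adjoint action and the right-invariant form -/

section Translations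

variable {E : Type*} [NormedAddCommGroup E] [NormedSpace ℝ E]
  {G : Type*} [TopologicalSpace G] [ChartedSpace E G] [Group G]

/-- The right-invariant form `dg g⁻¹`, on the model vector space. -/
def rMC (g : G) : E →L[ℝ] E := modelDeriv 𝓘(ℝ, E) 𝓘(ℝ, E) (fun k : G => k * g⁻¹) g

theorem rMC_one : (rMC (1 : G) : E →L[ℝ] E) = ContinuousLinearMap.id ℝ E := by
  unfold rMC
  simp only [inv_one, mul_one]
  exact modelDeriv_id _

theorem Ad_eq (g : G) :
    (Ad g : E →L[ℝ] E) = modelDeriv 𝓘(ℝ, E) 𝓘(ℝ, E) (fun k : G => g * k * g⁻¹) 1 := rfl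

theorem Ad_one : (Ad (1 : G) : E →L[ℝ] E) = ContinuousLinearMap.id ℝ E := by
  rw [Ad_eq]
  simp only [one_mul, inv_one, mul_one]
  exact modelDeriv_id _

variable [LieGroup 𝓘(ℝ, E) ∞ G]

theorem mdiff_mul_right (g k : G) :
    MDifferentiableAt 𝓘(ℝ, E) 𝓘(ℝ, E) (fun x : G => x * g) k :=
  ((contMDiff_mul_right (I := 𝓘(ℝ, E)) (n := ∞) (a := g)).mdifferentiable (by simp)) k

theorem mdiff_mul_left (g k : G) :
    MDifferentiableAt 𝓘(ℝ, E) 𝓘(ℝ, E) (fun x : G => g * x) k :=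
  ((contMDiff_mul_left (I := 𝓘(ℝ, E)) (n := ∞) (a := g)).mdifferentiable (by simp)) k

theorem mdiff_conj (g k : G) :
    MDifferentiableAt 𝓘(ℝ, E) 𝓘(ℝ, E) (fun x : G => g * x * g⁻¹) k :=
  MDifferentiableAt.comp k (mdiff_mul_right g⁻¹ (g * k)) (mdiff_mul_left g k)

theorem rMC_comp_mul_right (k g : G) :
    (rMC (k * g)).comp (modelDeriv 𝓘(ℝ, E) 𝓘(ℝ, E) (fun x : G => x * g) k) = (rMC k : E →L[ℝ] E) := by
  unfold rMC
  rw [← modelDeriv_comp (mdiff_mul_right _ _) (mdiff_mul_right g k) rfl]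
  congr 1
  ext x
  group

theorem rMC_comp_mul_right_one (g : G) :
    (rMC g).comp (modelDeriv 𝓘(ℝ, E) 𝓘(ℝ, E) (fun x : G => x * g) 1) =
      ContinuousLinearMap.id ℝ E := by
  unfold rMC
  rw [← modelDeriv_comp (mdiff_mul_right _ _) (mdiff_mul_right g 1) (one_mul g)]
  simp only [mul_inv_cancel_right]
  exact modelDeriv_id _

theorem mul_right_one_comp_rMC (g : G) :
    (modelDeriv 𝓘(ℝ, E) 𝓘(ℝ, E) (fun x : G => x * g) 1).comp (rMC g) =
      ContinuousLinearMap.id ℝ E := by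
  unfold rMC
  rw [← modelDeriv_comp (mdiff_mul_right _ _) (mdiff_mul_right _ _) (mul_inv_cancel g)]
  simp only [inv_mul_cancel_right]
  exact modelDeriv_id _

theorem rMC_bijective (g : G) : Function.Bijective (rMC g : E →L[ℝ] E) := by
  refine ⟨fun v w h => ?_, fun v => ⟨modelDeriv 𝓘(ℝ, E) 𝓘(ℝ, E) (fun x : G => x * g) 1 v, ?_⟩⟩
  · have h1 := fun z => congrArg (fun L => L z) (mul_right_one_comp_rMC (E := E) g)
    simp only [ContinuousLinearMap.comp_apply, ContinuousLinearMap.id_apply] at h1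
    rw [← h1 v, ← h1 w, h]
  · exact congrArg (fun L => L v) (rMC_comp_mul_right_one (E := E) g)

theorem Ad_mul (g h : G) : (Ad (g * h) : E →L[ℝ] E) = (Ad g).comp (Ad h) := by
  simp only [Ad_eq]
  rw [← modelDeriv_comp (mdiff_conj _ _) (mdiff_conj _ _) (by simp)]
  congr 1
  ext x
  group

theorem Ad_inv_comp (g : G) : (Ad g⁻¹ : E →L[ℝ] E).comp (Ad g) = ContinuousLinearMap.id ℝ E := by
  rw [← Ad_mul, inv_mul_cancel, Ad_one]

theorem Ad_inv_apply (g : G) (v : E) : (Ad g⁻¹ : E →L[ℝ] E) (Ad g v) = v :=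
  congrArg (fun L => L v) (Ad_inv_comp (E := E) g)

/-- Both sides differentiate $x\mapsto ax(ak)^{-1}=a(xk^{-1})a^{-1}$ at $k$. -/
theorem rMC_comp_mul_left (a k : G) :
    (rMC (a * k)).comp (modelDeriv 𝓘(ℝ, E) 𝓘(ℝ, E) (fun x : G => a * x) k) =
      (Ad a : E →L[ℝ] E).comp (rMC k) := by
  unfold rMC
  rw [Ad_eq, ← modelDeriv_comp (mdiff_mul_right _ _) (mdiff_mul_left _ _) rfl,
    ← modelDeriv_comp (mdiff_conj _ _) (mdiff_mul_right _ _) (by simp)]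
  congr 1
  ext x
  group

theorem leftMC_eq (g : G) : leftMC g = ((Ad g⁻¹ : E →L[ℝ] E).comp (rMC g) : E →L[ℝ] E) := by
  have h : ((Ad g⁻¹ : E →L[ℝ] E).comp (rMC g) : E →L[ℝ] E) =
      modelDeriv 𝓘(ℝ, E) 𝓘(ℝ, E) (fun x : G => g⁻¹ * x) g := by
    unfold rMC
    rw [Ad_eq, ← modelDeriv_comp (mdiff_conj _ _) (mdiff_mul_right _ _) (by simp)]
    congr 1
    ext x
    group
  rw [h]
  rfl

variable {F : Type*} [NormedAddCommGroup F] [NormedSpace ℝ F] {H : Type*} [TopologicalSpace H]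
  {I : ModelWithCorners ℝ F H} {M : Type*} [TopologicalSpace M] [ChartedSpace H M]

theorem mdiff_mul {f₁ f₂ : M → G} {p : M} (h₁ : MDifferentiableAt I 𝓘(ℝ, E) f₁ p)
    (h₂ : MDifferentiableAt I 𝓘(ℝ, E) f₂ p) :
    MDifferentiableAt I 𝓘(ℝ, E) (fun z => f₁ z * f₂ z) p :=
  MDifferentiableAt.comp p (I' := 𝓘(ℝ, E).prod 𝓘(ℝ, E))
    ((contMDiff_mul 𝓘(ℝ, E) (∞ : WithTop ℕ∞) (G := G)).mdifferentiable (by simp) (f₁ p, f₂ p))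
    (h₁.prodMk h₂)

theorem mdiff_inv {f : M → G} {p : M} (h : MDifferentiableAt I 𝓘(ℝ, E) f p) :
    MDifferentiableAt I 𝓘(ℝ, E) (fun z => (f z)⁻¹) p :=
  MDifferentiableAt.comp p (I' := 𝓘(ℝ, E))
    ((contMDiff_inv 𝓘(ℝ, E) (∞ : WithTop ℕ∞) (G := G)).mdifferentiable (by simp) (f p)) h

/-- The differential of multiplication is the sum of its two partial differentials: a right
translation, which $dg\,g^{-1}$ ignores, and a left translation, which it turns into $\mathrm{Ad}$.
-/
theorem rMC_modelDeriv_mul {f₁ f₂ : M → G} {p : M} (h₁ : MDifferentiableAt I 𝓘(ℝ, E) f₁ p)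
    (h₂ : MDifferentiableAt I 𝓘(ℝ, E) f₂ p) (v : F) :
    rMC (f₁ p * f₂ p) (modelDeriv I 𝓘(ℝ, E) (fun z => f₁ z * f₂ z) p v) =
      rMC (f₁ p) (modelDeriv I 𝓘(ℝ, E) f₁ p v) +
        Ad (f₁ p) (rMC (f₂ p) (modelDeriv I 𝓘(ℝ, E) f₂ p v)) := by
  have hm : MDifferentiableAt (𝓘(ℝ, E).prod 𝓘(ℝ, E)) 𝓘(ℝ, E)
      (fun q : G × G => q.1 * q.2) (f₁ p, f₂ p) :=
    (contMDiff_mul 𝓘(ℝ, E) (∞ : WithTop ℕ∞) (G := G)).mdifferentiable (by simp) _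
  rw [modelDeriv_comp (g := fun q : G × G => q.1 * q.2) (f := fun z => (f₁ z, f₂ z)) hm
    (h₁.prodMk h₂) rfl, modelDeriv_prodMk h₁ h₂, ContinuousLinearMap.comp_apply,
    modelDeriv_prod_apply hm, map_add]
  congr 1
  · exact congrArg (fun L => L (modelDeriv I 𝓘(ℝ, E) f₁ p v)) (rMC_comp_mul_right (f₁ p) (f₂ p))
  · exact congrArg (fun L => L (modelDeriv I 𝓘(ℝ, E) f₂ p v)) (rMC_comp_mul_left (f₁ p) (f₂ p))

end Translations

theorem two_le_infty : (2 : WithTop ℕ∞) ≤ ∞ :=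
  WithTop.coe_le_coe.2 (le_top : (2 : ℕ∞) ≤ ⊤)

/-! ### Preferred charts of a boundaryless manifold -/

section Charts

variable {E : Type*} [NormedAddCommGroup E] [NormedSpace ℝ E]
  {M : Type*} [TopologicalSpace M] [ChartedSpace E M] [IsManifold 𝓘(ℝ, E) ∞ M]

theorem contMDiffAt_chart {p q : M} (hq : q ∈ (extChartAt 𝓘(ℝ, E) p).source) :
    ContMDiffAt 𝓘(ℝ, E) 𝓘(ℝ, E) ∞ (extChartAt 𝓘(ℝ, E) p) q :=
  contMDiffAt_extChartAt' (by rwa [extChartAt_source] at hq)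

theorem contMDiffAt_chart_symm {p : M} {u : E} (hu : u ∈ (extChartAt 𝓘(ℝ, E) p).target) :
    ContMDiffAt 𝓘(ℝ, E) 𝓘(ℝ, E) ∞ (extChartAt 𝓘(ℝ, E) p).symm u :=
  (contMDiffOn_extChartAt_symm p).contMDiffAt ((isOpen_extChartAt_target p).mem_nhds hu)

theorem mdiff_chart {p q : M} (hq : q ∈ (extChartAt 𝓘(ℝ, E) p).source) :
    MDifferentiableAt 𝓘(ℝ, E) 𝓘(ℝ, E) (extChartAt 𝓘(ℝ, E) p) q :=
  (contMDiffAt_chart hq).mdifferentiableAt (by simp)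

theorem mdiff_chart_symm {p : M} {u : E} (hu : u ∈ (extChartAt 𝓘(ℝ, E) p).target) :
    MDifferentiableAt 𝓘(ℝ, E) 𝓘(ℝ, E) (extChartAt 𝓘(ℝ, E) p).symm u :=
  (contMDiffAt_chart_symm hu).mdifferentiableAt (by simp)

/-- The tangent space at `p` is identified with `E` by the preferred chart at `p` itself. -/
theorem modelDeriv_chart_self (p : M) :
    modelDeriv 𝓘(ℝ, E) 𝓘(ℝ, E) (extChartAt 𝓘(ℝ, E) p) p = ContinuousLinearMap.id ℝ E :=
  have : IsManifold 𝓘(ℝ, E) 1 M := IsManifold.of_le (n := ∞) (by simp)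
  mfderiv_extChartAt_self

theorem modelDeriv_chart_comp_symm {p : M} {u : E} (hu : u ∈ (extChartAt 𝓘(ℝ, E) p).target) :
    (modelDeriv 𝓘(ℝ, E) 𝓘(ℝ, E) (extChartAt 𝓘(ℝ, E) p) ((extChartAt 𝓘(ℝ, E) p).symm u)).comp
      (modelDeriv 𝓘(ℝ, E) 𝓘(ℝ, E) (extChartAt 𝓘(ℝ, E) p).symm u) =
      ContinuousLinearMap.id ℝ E := by
  rw [← modelDeriv_comp (mdiff_chart ((extChartAt 𝓘(ℝ, E) p).map_target hu))
    (mdiff_chart_symm hu) rfl, ← modelDeriv_id (I := 𝓘(ℝ, E)) u]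
  apply modelDeriv_congr
  filter_upwards [(isOpen_extChartAt_target p).mem_nhds hu] with v hv
  exact (extChartAt 𝓘(ℝ, E) p).right_inv hv

theorem modelDeriv_symm_comp_chart {p : M} {u : E} (hu : u ∈ (extChartAt 𝓘(ℝ, E) p).target) :
    (modelDeriv 𝓘(ℝ, E) 𝓘(ℝ, E) (extChartAt 𝓘(ℝ, E) p).symm u).comp
      (modelDeriv 𝓘(ℝ, E) 𝓘(ℝ, E) (extChartAt 𝓘(ℝ, E) p) ((extChartAt 𝓘(ℝ, E) p).symm u)) =
      ContinuousLinearMap.id ℝ E := by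
  have hs := (extChartAt 𝓘(ℝ, E) p).map_target hu
  rw [← modelDeriv_comp (mdiff_chart_symm hu) (mdiff_chart hs)
    ((extChartAt 𝓘(ℝ, E) p).right_inv hu),
    ← modelDeriv_id (I := 𝓘(ℝ, E)) ((extChartAt 𝓘(ℝ, E) p).symm u)]
  apply modelDeriv_congr
  filter_upwards [(isOpen_extChartAt_source p).mem_nhds hs] with v hv
  exact (extChartAt 𝓘(ℝ, E) p).left_inv hv

theorem modelDeriv_chart_symm_self (p : M) :
    modelDeriv 𝓘(ℝ, E) 𝓘(ℝ, E) (extChartAt 𝓘(ℝ, E) p).symm (extChartAt 𝓘(ℝ, E) p p) =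
      ContinuousLinearMap.id ℝ E := by
  have h := modelDeriv_symm_comp_chart (mem_extChartAt_target (I := 𝓘(ℝ, E)) p)
  rwa [extChartAt_to_inv, modelDeriv_chart_self, ContinuousLinearMap.comp_id] at h

end Charts

/-! ### Invariant frames and the multiplication in the chart at the identity -/

section Bracket

variable {E : Type*} [NormedAddCommGroup E] [NormedSpace ℝ E]
  {G : Type*} [TopologicalSpace G] [ChartedSpace E G] [Group G]

variable (E G) in
/-- The group multiplication in the chart at the identity. -/
def chartMul (p : E × E) : E :=
  extChartAt 𝓘(ℝ, E) (1 : G)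
    ((extChartAt 𝓘(ℝ, E) (1 : G)).symm p.1 * (extChartAt 𝓘(ℝ, E) (1 : G)).symm p.2)

variable (E G) in
/-- The coordinates of the identity. -/
def chartOne : E := extChartAt 𝓘(ℝ, E) (1 : G) 1

variable (G) in
/-- The right-invariant vector fields in the chart at the identity. -/
def rightFrame (u : E) : E →L[ℝ] E :=
  (fderiv ℝ (chartMul E G) (chartOne E G, u)).comp (ContinuousLinearMap.inl ℝ E E)

variable (G) in
/-- The left-invariant vector fields in the chart at the identity. -/
def leftFrame (u : E) : E →L[ℝ] E :=
  (fderiv ℝ (chartMul E G) (u, chartOne E G)).comp (ContinuousLinearMap.inr ℝ E E)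

variable (E G) in
/-- The Lie bracket of right-invariant vector fields, as a bilinear map on the model space. -/
def bracket : E →L[ℝ] E →L[ℝ] E :=
  fderiv ℝ (rightFrame G) (chartOne E G) - (fderiv ℝ (rightFrame G) (chartOne E G)).flip

/-- The right-invariant form `dg g⁻¹` in the chart at `g`. -/
def rMCChart (g : G) (u : E) : E →L[ℝ] E :=
  (rMC ((extChartAt 𝓘(ℝ, E) g).symm u)).comp
    (modelDeriv 𝓘(ℝ, E) 𝓘(ℝ, E) (extChartAt 𝓘(ℝ, E) g).symm u)

variable (G) in
/-- The adjoint action in the chart at the identity. -/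
def AdChart (u : E) : E →L[ℝ] E := Ad ((extChartAt 𝓘(ℝ, E) (1 : G)).symm u)

theorem chartOne_symm : (extChartAt 𝓘(ℝ, E) (1 : G)).symm (chartOne E G) = 1 :=
  extChartAt_to_inv (I := 𝓘(ℝ, E)) (1 : G)

theorem chartOne_mem_target : chartOne E G ∈ (extChartAt 𝓘(ℝ, E) (1 : G)).target :=
  mem_extChartAt_target (I := 𝓘(ℝ, E)) (1 : G)

theorem target_mem_nhds_chartOne :
    (extChartAt 𝓘(ℝ, E) (1 : G)).target ∈ 𝓝 (chartOne E G) :=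
  (isOpen_extChartAt_target (I := 𝓘(ℝ, E)) (1 : G)).mem_nhds chartOne_mem_target

theorem bracket_apply (ξ η : E) : bracket E G ξ η =
    fderiv ℝ (rightFrame G) (chartOne E G) ξ η - fderiv ℝ (rightFrame G) (chartOne E G) η ξ := rfl

theorem bracket_swap (ξ η : E) : bracket E G ξ η = -bracket E G η ξ := by
  rw [bracket_apply, bracket_apply, neg_sub]

theorem AdChart_chartOne : AdChart G (chartOne E G) = ContinuousLinearMap.id ℝ E := by
  rw [AdChart, chartOne_symm, Ad_one]

variable [LieGroup 𝓘(ℝ, E) ∞ G]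

theorem contDiffAt_chartMul {u v : E} (hu : u ∈ (extChartAt 𝓘(ℝ, E) (1 : G)).target)
    (hv : v ∈ (extChartAt 𝓘(ℝ, E) (1 : G)).target)
    (huv : (extChartAt 𝓘(ℝ, E) (1 : G)).symm u * (extChartAt 𝓘(ℝ, E) (1 : G)).symm v ∈
      (extChartAt 𝓘(ℝ, E) (1 : G)).source) :
    ContDiffAt ℝ ∞ (chartMul E G) (u, v) := by
  have : IsManifold 𝓘(ℝ, E) ∞ G := LieGroup.toContMDiffMul.toIsManifold
  rw [← contMDiffAt_iff_contDiffAt]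
  have h1 : ContMDiffAt 𝓘(ℝ, E × E) 𝓘(ℝ, E) ∞
      (fun p : E × E => (extChartAt 𝓘(ℝ, E) (1 : G)).symm p.1) (u, v) :=
    ContMDiffAt.comp (u, v) (contMDiffAt_chart_symm hu) contDiff_fst.contMDiff.contMDiffAt
  have h2 : ContMDiffAt 𝓘(ℝ, E × E) 𝓘(ℝ, E) ∞
      (fun p : E × E => (extChartAt 𝓘(ℝ, E) (1 : G)).symm p.2) (u, v) :=
    ContMDiffAt.comp (u, v) (contMDiffAt_chart_symm hv) contDiff_snd.contMDiff.contMDiffAt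
  exact ContMDiffAt.comp (u, v) (contMDiffAt_chart huv) (h1.mul h2)

theorem contDiffAt_chartMul_one :
    ContDiffAt ℝ ∞ (chartMul E G) (chartOne E G, chartOne E G) := by
  apply contDiffAt_chartMul chartOne_mem_target chartOne_mem_target
  rw [chartOne_symm, mul_one]
  exact mem_extChartAt_source _

theorem rightFrame_eq {u : E} (hu : u ∈ (extChartAt 𝓘(ℝ, E) (1 : G)).target) :
    rightFrame G u =
      (modelDeriv 𝓘(ℝ, E) 𝓘(ℝ, E) (extChartAt 𝓘(ℝ, E) (1 : G))
        ((extChartAt 𝓘(ℝ, E) (1 : G)).symm u)).comp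
      (modelDeriv 𝓘(ℝ, E) 𝓘(ℝ, E)
        (fun x : G => x * (extChartAt 𝓘(ℝ, E) (1 : G)).symm u) 1) := by
  have : IsManifold 𝓘(ℝ, E) ∞ G := LieGroup.toContMDiffMul.toIsManifold
  set k := (extChartAt 𝓘(ℝ, E) (1 : G)).symm u with hk
  have hks : k ∈ (extChartAt 𝓘(ℝ, E) (1 : G)).source := (extChartAt 𝓘(ℝ, E) (1 : G)).map_target hu
  have hd : DifferentiableAt ℝ (chartMul E G) (chartOne E G, u) := by
    refine (contDiffAt_chartMul chartOne_mem_target hu ?_).differentiableAt (by simp)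
    rwa [chartOne_symm, one_mul, ← hk]
  have h1 : fderiv ℝ (fun w => chartMul E G (w, u)) (chartOne E G) = rightFrame G u :=
    (HasFDerivAt.comp (chartOne E G) (f := fun w => (w, u)) hd.hasFDerivAt
      (hasFDerivAt_prodMk_left (chartOne E G) u)).fderiv
  rw [← h1, ← modelDeriv_eq_fderiv]
  have h2 : MDifferentiableAt 𝓘(ℝ, E) 𝓘(ℝ, E)
      (fun w => (extChartAt 𝓘(ℝ, E) (1 : G)).symm w * k) (chartOne E G) :=
    MDifferentiableAt.comp (chartOne E G) (mdiff_mul_right k _)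
      (mdiff_chart_symm chartOne_mem_target)
  have h3 := modelDeriv_comp (mdiff_chart hks) h2 (by rw [chartOne_symm, one_mul])
  have h4 := modelDeriv_comp (mdiff_mul_right k 1) (mdiff_chart_symm (E := E) (M := G)
    chartOne_mem_target) chartOne_symm
  rw [h4, chartOne, modelDeriv_chart_symm_self, ContinuousLinearMap.comp_id] at h3
  exact h3

theorem leftFrame_eq {u : E} (hu : u ∈ (extChartAt 𝓘(ℝ, E) (1 : G)).target) :
    leftFrame G u =
      (modelDeriv 𝓘(ℝ, E) 𝓘(ℝ, E) (extChartAt 𝓘(ℝ, E) (1 : G))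
        ((extChartAt 𝓘(ℝ, E) (1 : G)).symm u)).comp
      (modelDeriv 𝓘(ℝ, E) 𝓘(ℝ, E)
        (fun x : G => (extChartAt 𝓘(ℝ, E) (1 : G)).symm u * x) 1) := by
  have : IsManifold 𝓘(ℝ, E) ∞ G := LieGroup.toContMDiffMul.toIsManifold
  set k := (extChartAt 𝓘(ℝ, E) (1 : G)).symm u with hk
  have hks : k ∈ (extChartAt 𝓘(ℝ, E) (1 : G)).source := (extChartAt 𝓘(ℝ, E) (1 : G)).map_target hu
  have hd : DifferentiableAt ℝ (chartMul E G) (u, chartOne E G) := by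
    refine (contDiffAt_chartMul hu chartOne_mem_target ?_).differentiableAt (by simp)
    rwa [chartOne_symm, mul_one, ← hk]
  have h1 : fderiv ℝ (fun w => chartMul E G (u, w)) (chartOne E G) = leftFrame G u :=
    (HasFDerivAt.comp (chartOne E G) (f := fun w => (u, w)) hd.hasFDerivAt
      (hasFDerivAt_prodMk_right u (chartOne E G))).fderiv
  rw [← h1, ← modelDeriv_eq_fderiv]
  have h2 : MDifferentiableAt 𝓘(ℝ, E) 𝓘(ℝ, E)
      (fun w => k * (extChartAt 𝓘(ℝ, E) (1 : G)).symm w) (chartOne E G) :=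
    MDifferentiableAt.comp (chartOne E G) (mdiff_mul_left k _)
      (mdiff_chart_symm chartOne_mem_target)
  have h3 := modelDeriv_comp (mdiff_chart hks) h2 (by rw [chartOne_symm, mul_one])
  have h4 := modelDeriv_comp (mdiff_mul_left k 1) (mdiff_chart_symm (E := E) (M := G)
    chartOne_mem_target) chartOne_symm
  rw [h4, chartOne, modelDeriv_chart_symm_self, ContinuousLinearMap.comp_id] at h3
  exact h3

theorem rMCChart_comp_rightFrame {u : E} (hu : u ∈ (extChartAt 𝓘(ℝ, E) (1 : G)).target) :
    (rMCChart (1 : G) u).comp (rightFrame G u) = ContinuousLinearMap.id ℝ E := by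
  have : IsManifold 𝓘(ℝ, E) ∞ G := LieGroup.toContMDiffMul.toIsManifold
  ext v
  have h1 := fun w => congrArg (fun L => L w) (modelDeriv_symm_comp_chart hu)
  have h2 := congrArg (fun L => L v)
    (rMC_comp_mul_right_one (E := E) ((extChartAt 𝓘(ℝ, E) (1 : G)).symm u))
  simp only [ContinuousLinearMap.comp_apply, ContinuousLinearMap.id_apply] at h1 h2
  rw [rightFrame_eq hu, rMCChart]
  simp only [ContinuousLinearMap.comp_apply, ContinuousLinearMap.id_apply]
  rw [h1, h2]

theorem rightFrame_comp_rMCChart {u : E} (hu : u ∈ (extChartAt 𝓘(ℝ, E) (1 : G)).target) :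
    (rightFrame G u).comp (rMCChart (1 : G) u) = ContinuousLinearMap.id ℝ E := by
  have : IsManifold 𝓘(ℝ, E) ∞ G := LieGroup.toContMDiffMul.toIsManifold
  ext v
  have h1 := congrArg (fun L => L v) (modelDeriv_chart_comp_symm hu)
  have h2 := fun w => congrArg (fun L => L w)
    (mul_right_one_comp_rMC (E := E) ((extChartAt 𝓘(ℝ, E) (1 : G)).symm u))
  simp only [ContinuousLinearMap.comp_apply, ContinuousLinearMap.id_apply] at h1 h2
  rw [rightFrame_eq hu, rMCChart]
  simp only [ContinuousLinearMap.comp_apply, ContinuousLinearMap.id_apply]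
  rw [h2, h1]

theorem rMCChart_self (g : G) : rMCChart g (extChartAt 𝓘(ℝ, E) g g) = rMC g := by
  have : IsManifold 𝓘(ℝ, E) ∞ G := LieGroup.toContMDiffMul.toIsManifold
  rw [rMCChart, modelDeriv_chart_symm_self, extChartAt_to_inv, ContinuousLinearMap.comp_id]

theorem rMCChart_chartOne : rMCChart (1 : G) (chartOne E G) = ContinuousLinearMap.id ℝ E := by
  rw [chartOne, rMCChart_self, rMC_one]

theorem rightFrame_chartOne : rightFrame G (chartOne E G) = ContinuousLinearMap.id ℝ E := by
  have h := rMCChart_comp_rightFrame (G := G) (chartOne_mem_target (E := E))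
  rwa [rMCChart_chartOne, ContinuousLinearMap.id_comp] at h

/-- Conjugation by $g$ followed by right translation by $g$ is left translation by $g$. -/
theorem rightFrame_comp_AdChart {u : E} (hu : u ∈ (extChartAt 𝓘(ℝ, E) (1 : G)).target) :
    (rightFrame G u).comp (AdChart G u) = leftFrame G u := by
  rw [rightFrame_eq hu, leftFrame_eq hu, ContinuousLinearMap.comp_assoc, AdChart, Ad_eq,
    ← modelDeriv_comp (mdiff_mul_right _ _) (mdiff_conj _ _) (by simp)]
  simp only [inv_mul_cancel_right]

theorem AdChart_eq {u : E} (hu : u ∈ (extChartAt 𝓘(ℝ, E) (1 : G)).target) :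
    AdChart G u = (rMCChart (1 : G) u).comp (leftFrame G u) := by
  rw [← rightFrame_comp_AdChart hu, ← ContinuousLinearMap.comp_assoc,
    rMCChart_comp_rightFrame hu, ContinuousLinearMap.id_comp]

theorem leftFrame_chartOne : leftFrame G (chartOne E G) = ContinuousLinearMap.id ℝ E := by
  rw [← rightFrame_comp_AdChart chartOne_mem_target, AdChart_chartOne, rightFrame_chartOne,
    ContinuousLinearMap.comp_id]

theorem differentiableAt_fderiv_chartMul :
    DifferentiableAt ℝ (fderiv ℝ (chartMul E G)) (chartOne E G, chartOne E G) :=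
  (contDiffAt_chartMul_one.fderiv_right (m := 1) (one_add_one_eq_two.trans_le two_le_infty)).differentiableAt (by simp)

theorem hasFDerivAt_rightFrame :
    ∃ D : E →L[ℝ] E →L[ℝ] E, HasFDerivAt (rightFrame G) D (chartOne E G) ∧ ∀ v w, D v w =
      fderiv ℝ (fderiv ℝ (chartMul E G)) (chartOne E G, chartOne E G) (0, v) (w, 0) := by
  have h := HasFDerivAt.comp (chartOne E G) (f := fun w => (chartOne E G, w))
    (differentiableAt_fderiv_chartMul (E := E) (G := G)).hasFDerivAt
    (hasFDerivAt_prodMk_right (𝕜 := ℝ) (chartOne E G) (chartOne E G))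
  have h' := h.clm_comp (hasFDerivAt_const (ContinuousLinearMap.inl ℝ E E) (chartOne E G))
  refine ⟨_, h', fun v w => ?_⟩
  simp

theorem hasFDerivAt_leftFrame :
    ∃ D : E →L[ℝ] E →L[ℝ] E, HasFDerivAt (leftFrame G) D (chartOne E G) ∧ ∀ v w, D v w =
      fderiv ℝ (fderiv ℝ (chartMul E G)) (chartOne E G, chartOne E G) (v, 0) (0, w) := by
  have h := HasFDerivAt.comp (chartOne E G) (f := fun w => (w, chartOne E G))
    (differentiableAt_fderiv_chartMul (E := E) (G := G)).hasFDerivAt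
    (hasFDerivAt_prodMk_left (𝕜 := ℝ) (chartOne E G) (chartOne E G))
  have h' := h.clm_comp (hasFDerivAt_const (ContinuousLinearMap.inr ℝ E E) (chartOne E G))
  refine ⟨_, h', fun v w => ?_⟩
  simp

theorem differentiableAt_rightFrame : DifferentiableAt ℝ (rightFrame G) (chartOne E G) :=
  let ⟨_, h, _⟩ := hasFDerivAt_rightFrame (E := E) (G := G)
  h.differentiableAt

theorem differentiableAt_leftFrame : DifferentiableAt ℝ (leftFrame G) (chartOne E G) :=
  let ⟨_, h, _⟩ := hasFDerivAt_leftFrame (E := E) (G := G)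
  h.differentiableAt

/-- Both sides are mixed second derivatives of the same multiplication map, taken in opposite
orders. -/
theorem fderiv_leftFrame_apply (v w : E) :
    fderiv ℝ (leftFrame G) (chartOne E G) v w = fderiv ℝ (rightFrame G) (chartOne E G) w v := by
  obtain ⟨D, hD, hD'⟩ := hasFDerivAt_rightFrame (E := E) (G := G)
  obtain ⟨D', hE, hE'⟩ := hasFDerivAt_leftFrame (E := E) (G := G)
  rw [hD.fderiv, hE.fderiv, hD', hE']
  exact (contDiffAt_chartMul_one.isSymmSndFDerivAt (by simpa using two_le_infty)).eq _ _

end Bracket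

/-! ### Derivative of the adjoint action; the bracket of right-invariant fields -/

section Adjoint

variable {E : Type*} [NormedAddCommGroup E] [NormedSpace ℝ E]
  {G : Type*} [TopologicalSpace G] [ChartedSpace E G] [Group G]

theorem Ad_eventuallyEq : (fun g : G => (Ad g : E →L[ℝ] E)) =ᶠ[𝓝 1]
    fun g => AdChart G (extChartAt 𝓘(ℝ, E) (1 : G) g) := by
  filter_upwards [extChartAt_source_mem_nhds (I := 𝓘(ℝ, E)) (1 : G)] with g hg
  rw [AdChart, (extChartAt 𝓘(ℝ, E) (1 : G)).left_inv hg]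

theorem chart_symm_mul_inv_self (g : G) :
    (extChartAt 𝓘(ℝ, E) g).symm (extChartAt 𝓘(ℝ, E) g g) * g⁻¹ = 1 := by
  rw [extChartAt_to_inv, mul_inv_cancel]

/-- Right translation by `g⁻¹`, from the chart at `g` to the chart at the identity. -/
def chartTranslate (g : G) (u : E) : E :=
  extChartAt 𝓘(ℝ, E) (1 : G) ((extChartAt 𝓘(ℝ, E) g).symm u * g⁻¹)

theorem chartTranslate_self (g : G) :
    chartTranslate g (extChartAt 𝓘(ℝ, E) g g) = chartOne E G := by
  rw [chartTranslate, chart_symm_mul_inv_self, chartOne]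

variable (G) in
/-- The right-invariant vector field of `ξ` in the chart at the identity. -/
def rightFieldChart (ξ : E) (u : E) : E :=
  VectorField.mpullbackWithin 𝓘(ℝ, E) 𝓘(ℝ, E) (extChartAt 𝓘(ℝ, E) (1 : G)).symm
    (rightField (G := G) ξ) (Set.range 𝓘(ℝ, E)) u

variable [LieGroup 𝓘(ℝ, E) ∞ G]

theorem contDiffAt_chartTranslate (g : G) {u : E} (hu : u ∈ (extChartAt 𝓘(ℝ, E) g).target)
    (hg : (extChartAt 𝓘(ℝ, E) g).symm u * g⁻¹ ∈ (extChartAt 𝓘(ℝ, E) (1 : G)).source) :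
    ContDiffAt ℝ ∞ (chartTranslate g) u := by
  have : IsManifold 𝓘(ℝ, E) ∞ G := LieGroup.toContMDiffMul.toIsManifold
  rw [← contMDiffAt_iff_contDiffAt]
  exact ContMDiffAt.comp u (contMDiffAt_chart hg)
    ((contMDiffAt_chart_symm hu).mul contMDiffAt_const)

/-- Reduces the differentiation of `Ad` at `g` to that at the identity. -/
theorem Ad_fun_eq (g : G) : (fun k : G => (Ad k : E →L[ℝ] E)) =
    fun k => (ContinuousLinearMap.compL ℝ E E E).flip (Ad g) (Ad (k * g⁻¹)) := by
  ext1 k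
  rw [ContinuousLinearMap.flip_apply, ContinuousLinearMap.compL_apply, ← Ad_mul,
    inv_mul_cancel_right]

theorem inverse_rightFrame {u : E} (hu : u ∈ (extChartAt 𝓘(ℝ, E) (1 : G)).target) :
    (rightFrame G u).inverse = rMCChart (1 : G) u :=
  ContinuousLinearMap.inverse_eq (rightFrame_comp_rMCChart hu) (rMCChart_comp_rightFrame hu)

theorem rightFieldChart_eq (ξ : E) {u : E} (hu : u ∈ (extChartAt 𝓘(ℝ, E) (1 : G)).target) :
    rightFieldChart G ξ u = rightFrame G u ξ := by
  have : IsManifold 𝓘(ℝ, E) ∞ G := LieGroup.toContMDiffMul.toIsManifold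
  have h : (modelDeriv 𝓘(ℝ, E) 𝓘(ℝ, E) (extChartAt 𝓘(ℝ, E) (1 : G)).symm u).inverse =
      modelDeriv 𝓘(ℝ, E) 𝓘(ℝ, E) (extChartAt 𝓘(ℝ, E) (1 : G))
        ((extChartAt 𝓘(ℝ, E) (1 : G)).symm u) :=
    ContinuousLinearMap.inverse_eq (modelDeriv_symm_comp_chart hu) (modelDeriv_chart_comp_symm hu)
  rw [rightFrame_eq hu, ← h, rightFieldChart, VectorField.mpullbackWithin_apply,
    modelWithCornersSelf_coe, Set.range_id, mfderivWithin_univ]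
  rfl

theorem rMCChart_eq (g : G) {u : E} (hu : u ∈ (extChartAt 𝓘(ℝ, E) g).target)
    (hg : (extChartAt 𝓘(ℝ, E) g).symm u * g⁻¹ ∈ (extChartAt 𝓘(ℝ, E) (1 : G)).source) :
    rMCChart g u = (rMCChart (1 : G) (chartTranslate g u)).comp (fderiv ℝ (chartTranslate g) u) := by
  have : IsManifold 𝓘(ℝ, E) ∞ G := LieGroup.toContMDiffMul.toIsManifold
  have ht := (extChartAt 𝓘(ℝ, E) (1 : G)).map_source hg
  have h1 : modelDeriv 𝓘(ℝ, E) 𝓘(ℝ, E) (fun v => (extChartAt 𝓘(ℝ, E) g).symm v * g⁻¹) u =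
      (modelDeriv 𝓘(ℝ, E) 𝓘(ℝ, E) (extChartAt 𝓘(ℝ, E) (1 : G)).symm (chartTranslate g u)).comp
        (fderiv ℝ (chartTranslate g) u) := by
    rw [← modelDeriv_eq_fderiv, ← modelDeriv_comp (y := chartTranslate g u) (mdiff_chart_symm ht)
      ((contDiffAt_chartTranslate g hu hg).differentiableAt (by simp)).mdifferentiableAt rfl]
    apply modelDeriv_congr
    have hc : ContinuousAt (fun v => (extChartAt 𝓘(ℝ, E) g).symm v * g⁻¹) u :=
      ((contMDiffAt_chart_symm hu).mul contMDiffAt_const).continuousAt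
    filter_upwards [hc ((isOpen_extChartAt_source (1 : G)).mem_nhds hg)] with v hv
    exact ((extChartAt 𝓘(ℝ, E) (1 : G)).left_inv hv).symm
  rw [rMCChart, rMCChart, ContinuousLinearMap.comp_assoc, ← h1, ← rMC_comp_mul_right _ g⁻¹,
    ContinuousLinearMap.comp_assoc, ← modelDeriv_comp (mdiff_mul_right _ _)
      (mdiff_chart_symm hu) rfl, chartTranslate, (extChartAt 𝓘(ℝ, E) (1 : G)).left_inv hg]

variable [CompleteSpace E]

theorem differentiableAt_rMCChart_one :
    DifferentiableAt ℝ (rMCChart (1 : G)) (chartOne E G) := by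
  have h : DifferentiableAt ℝ (ContinuousLinearMap.inverse : (E →L[ℝ] E) → (E →L[ℝ] E))
      (rightFrame G (chartOne E G)) := by
    rw [rightFrame_chartOne]
    exact (contDiffAt_map_inverse (n := 1) (ContinuousLinearEquiv.refl ℝ E)).differentiableAt
      (by simp)
  refine (h.comp _ differentiableAt_rightFrame).congr_of_eventuallyEq ?_
  filter_upwards [target_mem_nhds_chartOne] with u hu
  exact (inverse_rightFrame hu).symm

/-- The form and the frame are mutually inverse, and both equal the identity at the unit, so their
derivatives there are opposite. -/
theorem fderiv_rMCChart_one (v : E) :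
    fderiv ℝ (rMCChart (1 : G)) (chartOne E G) v = -fderiv ℝ (rightFrame G) (chartOne E G) v := by
  have h := (differentiableAt_rMCChart_one (E := E) (G := G)).hasFDerivAt.clm_comp
    (differentiableAt_rightFrame (E := E) (G := G)).hasFDerivAt
  have h2 : HasFDerivAt (𝕜 := ℝ) (fun u => (rMCChart (1 : G) u).comp (rightFrame G u)) 0 (chartOne E G) := by
    refine (hasFDerivAt_const (ContinuousLinearMap.id ℝ E) (chartOne E G)).congr_of_eventuallyEq ?_
    filter_upwards [target_mem_nhds_chartOne] with u hu
    exact rMCChart_comp_rightFrame hu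
  have h3 := DFunLike.congr_fun (h.unique h2) v
  ext w
  have h4 : _ = (0 : E) := congrArg (fun L : E →L[ℝ] E => L w) h3
  simp [rMCChart_chartOne, rightFrame_chartOne] at h4
  rw [neg_apply]
  exact eq_neg_of_add_eq_zero_right h4

/-- Here $\mathrm{Ad}$ is the right-invariant form applied to the left frame. The minus sign
reflects the convention that the bracket of $\mathfrak g$ is that of right-invariant fields. -/
theorem hasFDerivAt_AdChart :
    HasFDerivAt (AdChart G) (-bracket E G) (chartOne E G) := by
  have h := (differentiableAt_rMCChart_one (E := E) (G := G)).hasFDerivAt.clm_comp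
    (differentiableAt_leftFrame (E := E) (G := G)).hasFDerivAt
  have h2 : AdChart G =ᶠ[𝓝 (chartOne E G)]
      fun u => (rMCChart (1 : G) u).comp (leftFrame G u) := by
    filter_upwards [target_mem_nhds_chartOne] with u hu
    exact AdChart_eq hu
  refine (h.congr_of_eventuallyEq h2).congr_fderiv ?_
  ext v w
  simp [rMCChart_chartOne, leftFrame_chartOne, fderiv_rMCChart_one, fderiv_leftFrame_apply,
    bracket_apply]
  abel

theorem mdiff_Ad_one :
    MDifferentiableAt 𝓘(ℝ, E) 𝓘(ℝ, E →L[ℝ] E) (fun g : G => (Ad g : E →L[ℝ] E)) 1 := by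
  have : IsManifold 𝓘(ℝ, E) ∞ G := LieGroup.toContMDiffMul.toIsManifold
  refine MDifferentiableAt.congr_of_eventuallyEq ?_ Ad_eventuallyEq
  exact MDifferentiableAt.comp (1 : G) (g := AdChart G) (I' := 𝓘(ℝ, E))
    (hasFDerivAt_AdChart (E := E) (G := G)).differentiableAt.mdifferentiableAt
    (mdiff_chart (mem_extChartAt_source (1 : G)))

theorem modelDeriv_Ad_one :
    modelDeriv 𝓘(ℝ, E) 𝓘(ℝ, E →L[ℝ] E) (fun g : G => (Ad g : E →L[ℝ] E)) 1 = -bracket E G := by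
  have : IsManifold 𝓘(ℝ, E) ∞ G := LieGroup.toContMDiffMul.toIsManifold
  have h := hasFDerivAt_AdChart (E := E) (G := G)
  rw [modelDeriv_congr Ad_eventuallyEq,
    modelDeriv_comp (I' := 𝓘(ℝ, E)) h.differentiableAt.mdifferentiableAt
    (mdiff_chart (mem_extChartAt_source (1 : G))) rfl, modelDeriv_eq_fderiv, modelDeriv_chart_self,
    ContinuousLinearMap.comp_id]
  exact h.fderiv

theorem mdiff_Ad_mul_inv (g : G) :
    MDifferentiableAt 𝓘(ℝ, E) 𝓘(ℝ, E →L[ℝ] E) (fun k : G => (Ad (k * g⁻¹) : E →L[ℝ] E)) g :=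
  MDifferentiableAt.comp_of_eq g (f := fun k : G => k * g⁻¹) mdiff_Ad_one
    (mdiff_mul_right g⁻¹ g) (mul_inv_cancel g)

theorem mdiff_Ad (g : G) :
    MDifferentiableAt 𝓘(ℝ, E) 𝓘(ℝ, E →L[ℝ] E) (fun g : G => (Ad g : E →L[ℝ] E)) g := by
  rw [Ad_fun_eq g]
  exact MDifferentiableAt.comp g
    ((ContinuousLinearMap.compL ℝ E E E).flip (Ad g)).differentiableAt.mdifferentiableAt
    (mdiff_Ad_mul_inv g)

theorem modelDeriv_Ad_apply (g : G) (v : E) :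
    modelDeriv 𝓘(ℝ, E) 𝓘(ℝ, E →L[ℝ] E) (fun g : G => (Ad g : E →L[ℝ] E)) g v =
      -(bracket E G (rMC g v)).comp (Ad g) := by
  rw [Ad_fun_eq g, modelDeriv_comp (I' := 𝓘(ℝ, E →L[ℝ] E))
    ((ContinuousLinearMap.compL ℝ E E E).flip (Ad g)).differentiableAt.mdifferentiableAt
    (mdiff_Ad_mul_inv g) rfl, modelDeriv_eq_fderiv, ContinuousLinearMap.fderiv,
    modelDeriv_comp (g := fun k : G => (Ad k : E →L[ℝ] E)) (f := fun k : G => k * g⁻¹) mdiff_Ad_one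
    (mdiff_mul_right g⁻¹ g) (mul_inv_cancel g), modelDeriv_Ad_one]
  simp [rMC]

/-- Differentiate $\mathrm{Ad}_{gkg^{-1}}=\mathrm{Ad}_g\mathrm{Ad}_k\mathrm{Ad}_{g^{-1}}$ at $k=1$
along $\xi$ and evaluate at $\mathrm{Ad}_g\eta$. -/
theorem Ad_bracket (g : G) (ξ η : E) :
    Ad g (bracket E G ξ η) = bracket E G (Ad g ξ) (Ad g η) := by
  have h : (fun k : G => (Ad (g * k * g⁻¹) : E →L[ℝ] E)) = fun k =>
      ((ContinuousLinearMap.compL ℝ E E E (Ad g)).comp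
        ((ContinuousLinearMap.compL ℝ E E E).flip (Ad g⁻¹))) (Ad k) := by
    ext1 k
    rw [Ad_mul, Ad_mul]
    rfl
  have h1 := modelDeriv_comp (g := fun k : G => (Ad k : E →L[ℝ] E))
    (f := fun k : G => g * k * g⁻¹) mdiff_Ad_one (mdiff_conj g 1) (by simp)
  rw [h, modelDeriv_comp (I' := 𝓘(ℝ, E →L[ℝ] E))
    (ContinuousLinearMap.differentiableAt _).mdifferentiableAt mdiff_Ad_one rfl,
    modelDeriv_eq_fderiv, ContinuousLinearMap.fderiv, modelDeriv_Ad_one, ← Ad_eq] at h1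
  have h2 := congrArg (fun L => L ξ (Ad g η)) h1
  simp only [ContinuousLinearMap.comp_apply, ContinuousLinearMap.compL_apply,
    ContinuousLinearMap.flip_apply, neg_apply, map_neg, Ad_inv_apply,
    neg_inj] at h2
  exact h2

theorem mlieBracket_rightField (ξ η : E) :
    VectorField.mlieBracket 𝓘(ℝ, E) (rightField (G := G) ξ) (rightField (G := G) η) (1 : G) =
      bracket E G ξ η := by
  have : IsManifold 𝓘(ℝ, E) ∞ G := LieGroup.toContMDiffMul.toIsManifold
  -- By definition the bracket on a manifold is the vector-space bracket of the fields read in the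
  -- chart, carried back by the chart derivative.
  have h0 : VectorField.mlieBracket 𝓘(ℝ, E) (rightField (G := G) ξ) (rightField (G := G) η)
      (1 : G) = (modelDeriv 𝓘(ℝ, E) 𝓘(ℝ, E) (extChartAt 𝓘(ℝ, E) (1 : G)) 1).inverse
        (VectorField.lieBracketWithin ℝ (rightFieldChart G ξ) (rightFieldChart G η)
          ((extChartAt 𝓘(ℝ, E) (1 : G)).symm ⁻¹' Set.univ ∩ Set.range 𝓘(ℝ, E))
          (chartOne E G)) := rfl
  rw [h0, modelDeriv_chart_self, ContinuousLinearMap.inverse_id, ContinuousLinearMap.id_apply]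
  have hξ := fun ξ : E => Filter.eventually_of_mem target_mem_nhds_chartOne
    (fun u hu => rightFieldChart_eq (G := G) ξ hu)
  have hd := fun ξ : E => ((differentiableAt_rightFrame (E := E) (G := G)).hasFDerivAt.clm_apply
    (hasFDerivAt_const ξ (chartOne E G))).congr_of_eventuallyEq (hξ ξ)
  have h1 : ((extChartAt 𝓘(ℝ, E) (1 : G)).symm ⁻¹' Set.univ ∩ Set.range 𝓘(ℝ, E)) = Set.univ := by
    simp
  rw [h1, VectorField.lieBracketWithin_univ, VectorField.lieBracket]
  have h2 := fun ξ : E => (hd ξ).fderiv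
  have h3 := fun ξ : E => (hξ ξ).self_of_nhds
  rw [h2 ξ, h2 η, h3 ξ, h3 η]
  simp [rightFrame_chartOne, bracket_apply]
  rfl

end Adjoint

/-! ### The Maurer–Cartan equation at an arbitrary point -/

section MaurerCartan

variable {E : Type*} [NormedAddCommGroup E] [NormedSpace ℝ E] [CompleteSpace E]
  {G : Type*} [TopologicalSpace G] [ChartedSpace E G] [Group G] [LieGroup 𝓘(ℝ, E) ∞ G]

theorem rMCChart_eventuallyEq (g : G) :
    rMCChart g =ᶠ[𝓝 (extChartAt 𝓘(ℝ, E) g g)] fun u =>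
      (rMCChart (1 : G) (chartTranslate g u)).comp (fderiv ℝ (chartTranslate g) u) := by
  have : IsManifold 𝓘(ℝ, E) ∞ G := LieGroup.toContMDiffMul.toIsManifold
  have hu := mem_extChartAt_target (I := 𝓘(ℝ, E)) g
  have hc : ContinuousAt (fun v => (extChartAt 𝓘(ℝ, E) g).symm v * g⁻¹) (extChartAt 𝓘(ℝ, E) g g) :=
    ((contMDiffAt_chart_symm hu).mul contMDiffAt_const).continuousAt
  have hs : (extChartAt 𝓘(ℝ, E) (1 : G)).source ∈
      𝓝 ((extChartAt 𝓘(ℝ, E) g).symm (extChartAt 𝓘(ℝ, E) g g) * g⁻¹) := by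
    rw [chart_symm_mul_inv_self]
    exact extChartAt_source_mem_nhds 1
  filter_upwards [hc hs, (isOpen_extChartAt_target g).mem_nhds hu] with u h1 h2
  exact rMCChart_eq g h2 h1

/-- The Maurer–Cartan equation for `dg g⁻¹`. -/
theorem exists_hasFDerivAt_rMCChart (g : G) :
    ∃ D : E →L[ℝ] E →L[ℝ] E, HasFDerivAt (rMCChart g) D (extChartAt 𝓘(ℝ, E) g g) ∧
      ∀ v w, D v w - D w v = -bracket E G (rMC g v) (rMC g w) := by
  have : IsManifold 𝓘(ℝ, E) ∞ G := LieGroup.toContMDiffMul.toIsManifold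
  set u := extChartAt 𝓘(ℝ, E) g g with hu
  have hcd : ContDiffAt ℝ ∞ (chartTranslate g) u := by
    apply contDiffAt_chartTranslate g (mem_extChartAt_target g)
    rw [chart_symm_mul_inv_self]
    exact mem_extChartAt_source 1
  have h1 : HasFDerivAt (rMCChart (1 : G)) (fderiv ℝ (rMCChart (1 : G)) (chartOne E G))
      (chartTranslate g u) := by
    rw [hu, chartTranslate_self]
    exact differentiableAt_rMCChart_one.hasFDerivAt
  have h2 := h1.comp u (hcd.differentiableAt (by simp)).hasFDerivAt
  have h3 : DifferentiableAt ℝ (fderiv ℝ (chartTranslate g)) u :=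
    (hcd.fderiv_right (m := 1) (one_add_one_eq_two.trans_le two_le_infty)).differentiableAt (by simp)
  -- Near `g` the form is the pull-back, by right translation by `g⁻¹`, of the form near the
  -- identity, whose derivative there is known.
  have h4 := (h2.clm_comp h3.hasFDerivAt).congr_of_eventuallyEq (rMCChart_eventuallyEq g)
  refine ⟨_, h4, fun v w => ?_⟩
  have h5 : fderiv ℝ (chartTranslate g) u = rMC g := by
    have h := (rMCChart_eventuallyEq (E := E) g).self_of_nhds
    simp only [rMCChart_self, chartTranslate_self] at h
    rw [rMCChart_chartOne, ContinuousLinearMap.id_comp] at h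
    exact h.symm
  -- The second derivative of the translation is symmetric, so it drops out of the
  -- antisymmetrization.
  have h6 := (hcd.isSymmSndFDerivAt (by simpa using two_le_infty)).eq v w
  simp [h5, fderiv_rMCChart_one, bracket_apply, h6]
  abel

end MaurerCartan

/-! ### The symplectic form in the right-invariant trivialization -/

section Symplectic

variable {E : Type*} [NormedAddCommGroup E] [NormedSpace ℝ E] [FiniteDimensional ℝ E]
  {G : Type*} [TopologicalSpace G] [ChartedSpace E G] [Group G]

/-- The Liouville form in the chart of `𝔤^* × G` at a point with group component `g`. -/
def liouvilleChart (g : G) (p : StrongDual ℝ E × E) :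
    (StrongDual ℝ E × E) [⋀^Fin 1]→L[ℝ] ℝ :=
  ContinuousAlternatingMap.ofSubsingletonLIE (𝕜 := ℝ) (0 : Fin 1)
    ((p.1 : E →L[ℝ] ℝ).comp ((rMCChart g p.2).comp (ContinuousLinearMap.snd ℝ (StrongDual ℝ E) E)))

theorem extChartAt_gpd_symm (q : Gpd E G) :
    ((extChartAt (modelGpd E) q).symm : StrongDual ℝ E × E → Gpd E G) =
      fun p => (p.1, (extChartAt 𝓘(ℝ, E) q.2).symm p.2) := rfl

theorem extChartAt_gpd_self (q : Gpd E G) :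
    extChartAt (modelGpd E) q q = (q.1, extChartAt 𝓘(ℝ, E) q.2 q.2) := rfl

variable [LieGroup 𝓘(ℝ, E) ∞ G]

/-- The chart of the product is the identity on $\mathfrak g^*$, so only the chart of the group
enters. -/
theorem chartRep_liouville (q : Gpd E G) {p : StrongDual ℝ E × E}
    (hp : p.2 ∈ (extChartAt 𝓘(ℝ, E) q.2).target) :
    chartRep (modelGpd E) liouville q p = liouvilleChart q.2 p := by
  have : IsManifold 𝓘(ℝ, E) ∞ G := LieGroup.toContMDiffMul.toIsManifold
  have h2 : MDifferentiableAt 𝓘(ℝ, StrongDual ℝ E × E) 𝓘(ℝ, E)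
      (fun p : StrongDual ℝ E × E => (extChartAt 𝓘(ℝ, E) q.2).symm p.2) p :=
    MDifferentiableAt.comp p (mdiff_chart_symm hp) differentiableAt_snd.mdifferentiableAt
  have h1 : MDifferentiableAt 𝓘(ℝ, StrongDual ℝ E × E) (modelGpd E)
      ((extChartAt (modelGpd E) q).symm : StrongDual ℝ E × E → Gpd E G) p := by
    rw [extChartAt_gpd_symm]
    exact (differentiableAt_fst.mdifferentiableAt).prodMk h2
  have h3 : (modelDeriv (modelGpd E) 𝓘(ℝ, E) (Prod.snd : Gpd E G → G)
      ((extChartAt (modelGpd E) q).symm p)).comp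
        (modelDeriv 𝓘(ℝ, StrongDual ℝ E × E) (modelGpd E) (extChartAt (modelGpd E) q).symm p) =
      (modelDeriv 𝓘(ℝ, E) 𝓘(ℝ, E) (extChartAt 𝓘(ℝ, E) q.2).symm p.2).comp
        (ContinuousLinearMap.snd ℝ (StrongDual ℝ E) E) := by
    rw [← modelDeriv_comp mdifferentiableAt_snd h1 rfl]
    have h4 := modelDeriv_comp (I := 𝓘(ℝ, StrongDual ℝ E × E)) (mdiff_chart_symm hp)
      (f := Prod.snd) (p := p) differentiableAt_snd.mdifferentiableAt rfl
    rw [modelDeriv_eq_fderiv, fderiv_snd] at h4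
    exact h4
  ext v
  have h5 := DFunLike.congr_fun h3 (v 0)
  have h6 : chartRep (modelGpd E) liouville q p v =
      p.1 (rMC ((extChartAt 𝓘(ℝ, E) q.2).symm p.2)
        ((modelDeriv (modelGpd E) 𝓘(ℝ, E) (Prod.snd : Gpd E G → G)
      ((extChartAt (modelGpd E) q).symm p)).comp
        (modelDeriv 𝓘(ℝ, StrongDual ℝ E × E) (modelGpd E) (extChartAt (modelGpd E) q).symm p)
          (v 0))) := by
    unfold chartRep
    rw [ModelWithCorners.range_eq_univ, mfderivWithin_univ]
    rfl
  rw [h6, h5]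
  rfl

theorem modelDeriv_extChartAt_gpd (q : Gpd E G) :
    modelDeriv (modelGpd E) 𝓘(ℝ, StrongDual ℝ E × E) (extChartAt (modelGpd E) q) q =
      ContinuousLinearMap.id ℝ (StrongDual ℝ E × E) := by
  have : IsManifold 𝓘(ℝ, E) ∞ G := LieGroup.toContMDiffMul.toIsManifold
  have : IsManifold 𝓘(ℝ, E) 1 G := IsManifold.of_le (n := ∞) (by simp)
  exact mfderiv_extChartAt_self

theorem extDeriv_liouvilleChart (g : G) (x : StrongDual ℝ E) (v w : StrongDual ℝ E × E) :
    extDeriv (liouvilleChart g) (x, extChartAt 𝓘(ℝ, E) g g) ![v, w] =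
      v.1 (rMC g w.2) - w.1 (rMC g v.2) - x (bracket E G (rMC g v.2) (rMC g w.2)) := by
  have : CompleteSpace E := FiniteDimensional.complete ℝ E
  obtain ⟨D, hD, hD'⟩ := exists_hasFDerivAt_rMCChart (E := E) g
  have h0 := rMCChart_self (E := E) g
  generalize extChartAt 𝓘(ℝ, E) g g = u at hD h0 ⊢
  have h1 : HasFDerivAt (fun p : StrongDual ℝ E × E => rMCChart g p.2)
      (D.comp (ContinuousLinearMap.snd ℝ (StrongDual ℝ E) E)) (x, u) :=
    HasFDerivAt.comp (x, u) (f := fun p : StrongDual ℝ E × E => p.2) hD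
      hasFDerivAt_snd
  have h2 := (hasFDerivAt_fst (𝕜 := ℝ) (p := (x, u))).clm_comp (h1.clm_comp
    (hasFDerivAt_const (ContinuousLinearMap.snd ℝ (StrongDual ℝ E) E) (x, u)))
  have h3 := (ContinuousAlternatingMap.ofSubsingletonLIE (𝕜 := ℝ) (E := StrongDual ℝ E × E) (F := ℝ)
    (0 : Fin 1)).toContinuousLinearEquiv.toContinuousLinearMap.hasFDerivAt.comp
      (x, u) h2
  have h4 : fderiv ℝ (liouvilleChart g) (x, u) = _ := h3.fderiv
  rw [extDeriv, h4, ContinuousAlternatingMap.alternatizeUncurryFin_apply, Fin.sum_univ_two]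
  have h5 := congrArg x (hD' v.2 w.2)
  have h6 : Fin.removeNth 1 ![v, w] 0 = v := rfl
  simp [h0, h6] at h5 ⊢
  linarith

theorem omega_eq (q : Gpd E G) (v w : StrongDual ℝ E × E) :
    formAt omega q ![v, w] =
      w.1 (rMC q.2 v.2) - v.1 (rMC q.2 w.2) + q.1 (bracket E G (rMC q.2 v.2) (rMC q.2 w.2)) := by
  have h1 : chartRep (modelGpd E) liouville q =ᶠ[𝓝 (extChartAt (modelGpd E) q q)]
      liouvilleChart q.2 := by
    have h := continuous_snd.continuousAt (x := (q.1, extChartAt 𝓘(ℝ, E) q.2 q.2))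
      ((isOpen_extChartAt_target (I := 𝓘(ℝ, E)) q.2).mem_nhds (mem_extChartAt_target q.2))
    rw [extChartAt_gpd_self]
    filter_upwards [h] with p hp
    exact chartRep_liouville q hp
  have h2 : formAt omega q ![v, w] =
      -(extDerivWithin (chartRep (modelGpd E) liouville q) (Set.range (modelGpd E))
        (extChartAt (modelGpd E) q q)) (fun i => modelDeriv (modelGpd E) 𝓘(ℝ, StrongDual ℝ E × E)
          (extChartAt (modelGpd E) q) q (![v, w] i)) := rfl
  rw [h2, ModelWithCorners.range_eq_univ, extDerivWithin_univ, h1.extDeriv_eq,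
    modelDeriv_extChartAt_gpd]
  simp only [ContinuousLinearMap.id_apply, extChartAt_gpd_self]
  rw [extDeriv_liouvilleChart]
  ring

end Symplectic

/-! ### Linear algebra of nondegenerate two-forms and their brackets -/

section TwoForms

variable {E : Type*} [NormedAddCommGroup E] [NormedSpace ℝ E] {H : Type*} [TopologicalSpace H]
  {I : ModelWithCorners ℝ E H} {M : Type*} [TopologicalSpace M] [ChartedSpace H M]
  {E' : Type*} [NormedAddCommGroup E'] [NormedSpace ℝ E'] {H' : Type*} [TopologicalSpace H']
  {I' : ModelWithCorners ℝ E' H'} {M' : Type*} [TopologicalSpace M'] [ChartedSpace H' M']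

theorem update_pair (v w : E) : Function.update ![v, 0] 1 w = ![v, w] := by
  ext i
  fin_cases i <;> rfl

/-- The bilinear form of an alternating two-form. -/
def toBilin (Om : E [⋀^Fin 2]→L[ℝ] ℝ) : E →ₗ[ℝ] E →ₗ[ℝ] ℝ :=
  LinearMap.mk₂ ℝ (fun v w => Om ![v, w])
    (fun v v' w => Om.toAlternatingMap.map_vecCons_add ![w] v v')
    (fun c v w => Om.toAlternatingMap.map_vecCons_smul ![w] c v)
    (fun v w w' => by
      have h := Om.toAlternatingMap.toMultilinearMap.map_update_add ![v, 0] 1 w w'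
      simp only [update_pair] at h
      exact h)
    (fun c v w => by
      have h := Om.toAlternatingMap.toMultilinearMap.map_update_smul ![v, 0] 1 c w
      simp only [update_pair] at h
      exact h)

theorem toBilin_apply (Om : E [⋀^Fin 2]→L[ℝ] ℝ) (v w : E) : toBilin Om v w = Om ![v, w] := rfl

theorem nondegenerateAt_of_injective [FiniteDimensional ℝ E] {Om : DiffForm I M 2} {p : M}
    (h : ∀ v : E, (∀ w : E, formAt Om p ![v, w] = 0) → v = 0) :
    NondegenerateAt I Om p := by
  have hinj : Function.Injective (toBilin (formAt Om p)) := by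
    rw [injective_iff_map_eq_zero]
    exact fun v hv => h v fun w => DFunLike.congr_fun hv w
  have hsurj : Function.Surjective (toBilin (formAt Om p)) :=
    (LinearMap.injective_iff_surjective_of_finrank_eq_finrank
      (Subspace.dual_finrank_eq (K := ℝ) (V := E)).symm).1 hinj
  intro α
  let β : E →L[ℝ] ℝ := α
  obtain ⟨v, hv⟩ := hsurj β.toLinearMap
  refine ⟨v, fun w => DFunLike.congr_fun hv w, fun v' hv' => hinj ?_⟩
  rw [hv]
  exact LinearMap.ext hv'

/-- Uniqueness in nondegeneracy identifies any solution `v` of the Hamiltonian equation with the one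
chosen by `sharp`. -/
theorem poissonBracket_eq {Om : DiffForm I M 2} {p : M} (h : NondegenerateAt I Om p)
    {f g : M → ℝ} (v : E)
    (hv : ∀ w : E, formAt Om p ![v, w] = modelDeriv I 𝓘(ℝ, ℝ) f p w) :
    poissonBracket I Om f g p = modelDeriv I 𝓘(ℝ, ℝ) g p v := by
  have hs : sharp I Om p (mfderiv I 𝓘(ℝ, ℝ) f p) = v := by
    obtain ⟨u, hu, huniq⟩ := h (mfderiv I 𝓘(ℝ, ℝ) f p)
    have h1 := Classical.epsilon_spec (p := fun v : TangentSpace I p =>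
      ∀ w, Om p ![v, w] = mfderiv I 𝓘(ℝ, ℝ) f p w) ⟨u, hu⟩
    exact (huniq _ h1).trans (huniq v hv).symm
  unfold poissonBracket
  rw [hs]
  rfl

theorem exists_hamiltonian {Om : DiffForm I M 2} {p : M} (h : NondegenerateAt I Om p)
    (f : M → ℝ) : ∃ v : E, ∀ w : E,
      formAt Om p ![v, w] = modelDeriv I 𝓘(ℝ, ℝ) f p w :=
  let ⟨v, hv, _⟩ := h (mfderiv I 𝓘(ℝ, ℝ) f p)
  ⟨v, hv⟩

theorem pullback_eq (f : M → M') (Om : DiffForm I' M' 2) (p : M) (v w : E) :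
    formAt (pullback I I' f Om) p ![v, w] =
      formAt Om (f p) ![modelDeriv I I' f p v, modelDeriv I I' f p w] := by
  have h : ![modelDeriv I I' f p v, modelDeriv I I' f p w] =
      fun i => modelDeriv I I' f p (![v, w] i) := by
    ext i
    fin_cases i <;> rfl
  have h' : formAt (pullback I I' f Om) p ![v, w] =
      formAt Om (f p) (fun i => modelDeriv I I' f p (![v, w] i)) := rfl
  rw [h', h]

theorem nondegenerateAt_pullback [FiniteDimensional ℝ E] {f : M → M'} {Om : DiffForm I' M' 2}
    {p : M} (h : NondegenerateAt I' Om (f p)) (hf : Function.Bijective (modelDeriv I I' f p)) :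
    NondegenerateAt I (pullback I I' f Om) p := by
  apply nondegenerateAt_of_injective
  intro v hv
  apply hf.1
  rw [map_zero]
  obtain ⟨u, _, hu⟩ := h 0
  have h1 : ∀ w : E', formAt Om (f p) ![modelDeriv I I' f p v, w] = 0 := by
    intro w
    obtain ⟨w, rfl⟩ := hf.2 w
    rw [← pullback_eq]
    exact hv w
  have h2 : ∀ w : E', formAt Om (f p) ![0, w] = 0 := fun w =>
    DFunLike.congr_fun (map_zero (toBilin (formAt Om (f p)))) w
  exact (hu _ h1).trans (hu _ h2).symm

/-- A preimage under the derivative of `f` of the Hamiltonian vector of `u` is Hamiltonian for the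
pulled-back function; only pointwise bijectivity of the derivative is needed. -/
theorem poissonBracket_pullback [FiniteDimensional ℝ E] {f : M → M'} {Om : DiffForm I' M' 2}
    {p : M} (h : NondegenerateAt I' Om (f p)) (hf : MDifferentiableAt I I' f p)
    (hb : Function.Bijective (modelDeriv I I' f p)) {u v : M' → ℝ}
    (hu : MDifferentiableAt I' 𝓘(ℝ, ℝ) u (f p)) (hv : MDifferentiableAt I' 𝓘(ℝ, ℝ) v (f p)) :
    poissonBracket I (pullback I I' f Om) (fun z => u (f z)) (fun z => v (f z)) p =
      poissonBracket I' Om u v (f p) := by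
  obtain ⟨Z, hZ⟩ := exists_hamiltonian h u
  obtain ⟨Y, rfl⟩ := hb.2 Z
  rw [poissonBracket_eq h _ hZ, poissonBracket_eq (nondegenerateAt_pullback h hb) Y,
    modelDeriv_comp hv hf rfl]
  · rfl
  · intro w
    rw [pullback_eq, hZ, modelDeriv_comp hu hf rfl]
    rfl

theorem alternating_two_ext {A B : E [⋀^Fin 2]→L[ℝ] ℝ}
    (h : ∀ v w : E, A ![v, w] = B ![v, w]) : A = B := by
  ext v
  have hv : v = ![v 0, v 1] := by
    ext i
    fin_cases i <;> rfl
  rw [hv]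
  exact h _ _

end TwoForms

/-! ### The action of a bisection and the decomposition of the pulled-back form -/

section Bisections

variable {E : Type*} [NormedAddCommGroup E] [NormedSpace ℝ E] [FiniteDimensional ℝ E]
  {G : Type*} [TopologicalSpace G] [ChartedSpace E G] [Group G]

variable (G) in
/-- The symplectic form of `𝔤^* × G` over `x`, in the right-invariant trivialization. -/
def omegaFrame (x : StrongDual ℝ E) (a b : StrongDual ℝ E × E) : ℝ :=
  b.1 a.2 - a.1 b.2 + x (bracket E G a.2 b.2)

namespace Bisection

variable (S : Bisection E G)

/-- The `G`-component of the section of the target map. -/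
def valT (y : StrongDual ℝ E) : G := S.val (S.r y)

/-- The derivative of the `G`-component of the section of the target map, in the right-invariant
trivialization. -/
def valTDeriv (y : StrongDual ℝ E) : StrongDual ℝ E →L[ℝ] E :=
  (rMC (S.valT y)).comp (modelDeriv (modelX E) 𝓘(ℝ, E) S.valT y)

theorem sec_eq (x : StrongDual ℝ E) : S.sec x = (x, S.val x) :=
  Prod.ext (S.source_sec x) rfl

theorem secT_eq (y : StrongDual ℝ E) : S.secT y = (S.r y, S.valT y) := S.sec_eq _

theorem R_eq (q : Gpd E G) : S.R q = (S.r q.1, S.valT q.1 * q.2) := by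
  rw [R, secT_eq]
  rfl

theorem l_r (y : StrongDual ℝ E) : S.l (S.r y) = y := S.l.apply_symm_apply y

theorem r_l (x : StrongDual ℝ E) : S.r (S.l x) = x := S.l.symm_apply_apply x

theorem r_comp_Ad (y : StrongDual ℝ E) : (S.r y).comp (Ad (S.valT y)) = y := by
  have h := S.target_sec (S.r y)
  rw [l_r, sec_eq] at h
  exact h

theorem mdiff_val (x : StrongDual ℝ E) : MDifferentiableAt (modelX E) 𝓘(ℝ, E) S.val x :=
  MDifferentiableAt.comp x (I' := modelGpd E) mdifferentiableAt_snd
    (S.contMDiff_sec.mdifferentiable (by simp) x)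

theorem differentiable_r : Differentiable ℝ S.r :=
  (S.l.symm.contMDiff.contDiff).differentiable (by simp)

theorem differentiable_l : Differentiable ℝ S.l :=
  (S.l.contMDiff.contDiff).differentiable (by simp)

theorem mdiff_valT (y : StrongDual ℝ E) : MDifferentiableAt (modelX E) 𝓘(ℝ, E) S.valT y :=
  MDifferentiableAt.comp y (I' := modelX E) (S.mdiff_val _) (S.differentiable_r y).mdifferentiableAt

theorem fderiv_l_comp_r (y : StrongDual ℝ E) :
    (fderiv ℝ S.l (S.r y)).comp (fderiv ℝ S.r y) = ContinuousLinearMap.id ℝ (StrongDual ℝ E) := by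
  rw [← fderiv_comp y (S.differentiable_l _) (S.differentiable_r _)]
  have h : (S.l ∘ S.r : StrongDual ℝ E → StrongDual ℝ E) = id := funext S.l_r
  rw [h, fderiv_id]

theorem fderiv_r_comp_l (x : StrongDual ℝ E) :
    (fderiv ℝ S.r (S.l x)).comp (fderiv ℝ S.l x) = ContinuousLinearMap.id ℝ (StrongDual ℝ E) := by
  rw [← fderiv_comp x (S.differentiable_r _) (S.differentiable_l _)]
  have h : (S.r ∘ S.l : StrongDual ℝ E → StrongDual ℝ E) = id := funext S.r_l
  rw [h, fderiv_id]

variable [LieGroup 𝓘(ℝ, E) ∞ G]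

/-- The infinitesimal form of `y = 𝒜⁻¹ r_Σ(y) 𝒜`. -/
theorem apply_eq (y v : StrongDual ℝ E) (ξ : E) :
    v ξ = fderiv ℝ S.r y v (Ad (S.valT y) ξ) -
      S.r y (bracket E G (S.valTDeriv y v) (Ad (S.valT y) ξ)) := by
  have : CompleteSpace E := FiniteDimensional.complete ℝ E
  have h1 : MDifferentiableAt (modelX E) 𝓘(ℝ, E →L[ℝ] E)
      (fun z => (Ad (S.valT z) : E →L[ℝ] E)) y :=
    MDifferentiableAt.comp y (I' := 𝓘(ℝ, E)) (mdiff_Ad (S.valT y)) (S.mdiff_valT y)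
  have h2 := modelDeriv_comp (mdiff_Ad (S.valT y)) (S.mdiff_valT y) rfl
  have h3 := (S.differentiable_r y).hasFDerivAt.clm_comp
    (mdifferentiableAt_iff_differentiableAt.1 h1).hasFDerivAt
  -- Two derivatives of one map: the product rule for $z\mapsto r_\Sigma(z)\circ\mathrm{Ad}$, and
  -- the identity, which this map equals by the target condition.
  have h4 := h3.unique ((hasFDerivAt_id y).congr_of_eventuallyEq
    (Filter.Eventually.of_forall S.r_comp_Ad))
  have h5 := DFunLike.congr_fun (DFunLike.congr_fun h4 v) ξ
  rw [← modelDeriv_eq_fderiv, h2] at h5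
  simp only [add_apply, ContinuousLinearMap.comp_apply,
    ContinuousLinearMap.compL_apply, ContinuousLinearMap.flip_apply, modelDeriv_Ad_apply,
    neg_apply, map_neg, ContinuousLinearMap.id_apply] at h5
  rw [← h5, valTDeriv]
  simp only [ContinuousLinearMap.comp_apply]
  ring

theorem mdiff_R (q : Gpd E G) : MDifferentiableAt (modelGpd E) (modelGpd E) S.R q := by
  have h := funext S.R_eq
  rw [h]
  refine MDifferentiableAt.prodMk ?_ (mdiff_mul ?_ mdifferentiableAt_snd)
  · exact MDifferentiableAt.comp q (I' := modelX E) (S.differentiable_r _).mdifferentiableAt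
      mdifferentiableAt_fst
  · exact MDifferentiableAt.comp q (g := S.valT) (I' := modelX E) (S.mdiff_valT _) mdifferentiableAt_fst

theorem modelDeriv_R (q : Gpd E G) (v : StrongDual ℝ E × E) :
    (modelDeriv (modelGpd E) (modelGpd E) S.R q v).1 = fderiv ℝ S.r q.1 v.1 ∧
    rMC (S.R q).2 (modelDeriv (modelGpd E) (modelGpd E) S.R q v).2 =
      S.valTDeriv q.1 v.1 + Ad (S.valT q.1) (rMC q.2 v.2) := by
  have h := funext S.R_eq
  have h1 : MDifferentiableAt (modelGpd E) (modelX E) (fun q : Gpd E G => S.r q.1) q :=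
    MDifferentiableAt.comp q (I' := modelX E) (S.differentiable_r _).mdifferentiableAt
      mdifferentiableAt_fst
  have h2 : MDifferentiableAt (modelGpd E) 𝓘(ℝ, E) (fun q : Gpd E G => S.valT q.1) q :=
    MDifferentiableAt.comp q (g := S.valT) (I' := modelX E) (S.mdiff_valT _) mdifferentiableAt_fst
  rw [h, modelDeriv_prodMk h1 (mdiff_mul h2 mdifferentiableAt_snd)]
  constructor
  · have h3 := modelDeriv_comp (I := modelGpd E) (f := fun q : Gpd E G => q.1) (p := q)
      (S.differentiable_r q.1).mdifferentiableAt mdifferentiableAt_fst rfl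
    rw [modelDeriv_fst, modelDeriv_eq_fderiv] at h3
    rw [h3]
    rfl
  · have h3 := modelDeriv_comp (I := modelGpd E) (f := fun q : Gpd E G => q.1) (p := q)
      (S.mdiff_valT q.1) mdifferentiableAt_fst rfl
    have h4 := rMC_modelDeriv_mul h2 mdifferentiableAt_snd v
    rw [modelDeriv_fst] at h3
    rw [h3, modelDeriv_snd] at h4
    exact h4

theorem modelDeriv_secT (y v : StrongDual ℝ E) :
    (modelDeriv (modelX E) (modelGpd E) S.secT y v).1 = fderiv ℝ S.r y v ∧
    rMC (S.secT y).2 (modelDeriv (modelX E) (modelGpd E) S.secT y v).2 = S.valTDeriv y v := by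
  have h := funext S.secT_eq
  rw [h, modelDeriv_prodMk (S.differentiable_r y).mdifferentiableAt (S.mdiff_valT y),
    modelDeriv_eq_fderiv]
  exact ⟨rfl, rfl⟩

theorem _root_.PoissonGauge.omega_eq_frame (q : Gpd E G) (v w : StrongDual ℝ E × E) :
    formAt omega q ![v, w] =
      omegaFrame G q.1 (v.1, rMC q.2 v.2) (w.1, rMC q.2 w.2) := omega_eq q v w

theorem Ft_eq (y v w : StrongDual ℝ E) :
    formAt S.Ft y ![v, w] =
      omegaFrame G (S.r y) (fderiv ℝ S.r y v, S.valTDeriv y v)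
        (fderiv ℝ S.r y w, S.valTDeriv y w) := by
  have hv := S.modelDeriv_secT y v
  have hw := S.modelDeriv_secT y w
  rw [Ft, pullback_eq, omega_eq_frame, hv.1, hv.2, hw.1, hw.2, secT_eq]

theorem omegaH_eq_frame (q : Gpd E G) (v w : StrongDual ℝ E × E) :
    formAt S.omegaH q ![v, w] =
      omegaFrame G (S.r q.1)
        (fderiv ℝ S.r q.1 v.1, S.valTDeriv q.1 v.1 + Ad (S.valT q.1) (rMC q.2 v.2))
        (fderiv ℝ S.r q.1 w.1, S.valTDeriv q.1 w.1 + Ad (S.valT q.1) (rMC q.2 w.2)) := by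
  have hv := S.modelDeriv_R q v
  have hw := S.modelDeriv_R q w
  rw [omegaH, pullback_eq, omega_eq_frame, hv.1, hv.2, hw.1, hw.2, R_eq]

/-- Expand bilinearly: the pure base terms form $F^t$, the mixed terms are $\pm$ instances of
`apply_eq`, and the pure group term is restored by invariance of the bracket under $\mathrm{Ad}$. -/
theorem omegaH_eq (q : Gpd E G) (v w : StrongDual ℝ E × E) :
    formAt S.omegaH q ![v, w] =
      omegaFrame G q.1 (v.1, rMC q.2 v.2) (w.1, rMC q.2 w.2) +
        formAt S.Ft q.1 ![v.1, w.1] := by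
  have : CompleteSpace E := FiniteDimensional.complete ℝ E
  rw [omegaH_eq_frame, Ft_eq]
  have h1 := S.apply_eq q.1 v.1 (rMC q.2 w.2)
  have h2 := S.apply_eq q.1 w.1 (rMC q.2 v.2)
  have h3 : q.1 (bracket E G (rMC q.2 v.2) (rMC q.2 w.2)) =
      S.r q.1 (bracket E G (Ad (S.valT q.1) (rMC q.2 v.2)) (Ad (S.valT q.1) (rMC q.2 w.2))) := by
    rw [← Ad_bracket]
    exact (DFunLike.congr_fun (S.r_comp_Ad q.1) _).symm
  simp only [omegaFrame, map_add, add_apply]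
  rw [h1, h2, h3, bracket_swap (S.valTDeriv q.1 w.1), map_neg]
  ring

theorem omegaH_decomp (q : Gpd E G) : S.omegaH q =
    -(extD (modelGpd E) liouville q) + pullback (modelGpd E) (modelX E) source S.Ft q := by
  apply alternating_two_ext (E := StrongDual ℝ E × E)
  intro v w
  have h1 := pullback_eq (I := modelGpd E) (I' := modelX E) (source : Gpd E G → StrongDual ℝ E)
    S.Ft q v w
  have h2 : modelDeriv (modelGpd E) (modelX E) (source : Gpd E G → StrongDual ℝ E) q =
    ContinuousLinearMap.fst ℝ (StrongDual ℝ E) E := modelDeriv_fst q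
  rw [h2] at h1
  have h3 := S.omegaH_eq q v w
  rw [← omega_eq_frame] at h3
  exact h3.trans (congrArg (_ + ·) h1.symm)

/-- The differential is block triangular in the trivialization, with the invertible diagonal blocks
$dr_\Sigma$ and $\mathrm{Ad}$. -/
theorem bijective_modelDeriv_R (q : Gpd E G) :
    Function.Bijective (modelDeriv (modelGpd E) (modelGpd E) S.R q) := by
  have hinj : Function.Injective (modelDeriv (modelGpd E) (modelGpd E) S.R q) := by
    rw [injective_iff_map_eq_zero]
    intro v hv
    obtain ⟨h1, h2⟩ := S.modelDeriv_R q v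
    rw [hv] at h1 h2
    have h3 : v.1 = 0 := by
      have h := DFunLike.congr_fun (S.fderiv_l_comp_r q.1) v.1
      rw [ContinuousLinearMap.comp_apply, ← h1] at h
      simpa using h.symm
    have h4 : v.2 = 0 := by
      apply (rMC_bijective q.2).1
      rw [map_zero, ← Ad_inv_apply (S.valT q.1) (rMC q.2 v.2)]
      rw [h3, map_zero, zero_add] at h2
      rw [← h2]
      simp
    exact Prod.ext h3 h4
  exact ⟨hinj, (LinearMap.injective_iff_surjective
    (f := (modelDeriv (modelGpd E) (modelGpd E) S.R q).toLinearMap)).1 hinj⟩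

theorem _root_.PoissonGauge.nondegenerateAt_omega (q : Gpd E G) :
    NondegenerateAt (modelGpd E) omega q := by
  apply nondegenerateAt_of_injective
  intro v hv
  have h1 : v.2 = 0 := by
    apply (rMC_bijective q.2).1
    rw [map_zero]
    by_contra hne
    obtain ⟨f, hf⟩ := SeparatingDual.exists_ne_zero (R := ℝ) hne
    have h := hv (f, 0)
    rw [omega_eq] at h
    simp at h
    exact hf h
  have h2 : v.1 = 0 := by
    ext ξ
    obtain ⟨w, rfl⟩ := (rMC_bijective q.2).2 ξ
    have h := hv (0, w)
    rw [omega_eq, h1] at h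
    simpa using h
  exact Prod.ext h2 h1

theorem nondegenerateAt_omegaH (q : Gpd E G) : NondegenerateAt (modelGpd E) S.omegaH q :=
  nondegenerateAt_pullback (nondegenerateAt_omega _) (S.bijective_modelDeriv_R q)

end Bisection

end Bisections

/-! ### Completeness of left-invariant fields and the derivative of the logarithm -/

section Exponential

variable {E : Type*} [NormedAddCommGroup E] [NormedSpace ℝ E]
  {G : Type*} [TopologicalSpace G] [ChartedSpace E G] [Group G] [LieGroup 𝓘(ℝ, E) ∞ G]

variable (G) in
/-- The left-invariant vector field of `ξ`. -/
abbrev leftField (ξ : E) (g : G) : TangentSpace 𝓘(ℝ, E) g :=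
  mulInvariantVectorField (I := 𝓘(ℝ, E)) (G := G) ξ g

theorem comp_smulRight_one (L : E →L[ℝ] E) {v w : E} (h : L v = w) :
    L.comp ((1 : ℝ →L[ℝ] ℝ).smulRight v) = (1 : ℝ →L[ℝ] ℝ).smulRight w := by
  ext
  simp [h]

theorem leftField_one (ξ : E) : leftField G ξ 1 = ξ := by
  have h : (modelDeriv 𝓘(ℝ, E) 𝓘(ℝ, E) (fun x : G => 1 * x) 1 : E →L[ℝ] E) ξ = ξ := by
    simp only [one_mul]
    rw [modelDeriv_id, ContinuousLinearMap.id_apply]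
  exact h

theorem leftField_mul (ξ : E) (g h : G) :
    modelDeriv 𝓘(ℝ, E) 𝓘(ℝ, E) (fun x : G => g * x) h (leftField G ξ h) =
      leftField G ξ (g * h) := by
  have h1 := modelDeriv_comp (mdiff_mul_left (E := E) g h) (mdiff_mul_left (E := E) h 1) (mul_one h)
  have h2 := DFunLike.congr_fun h1 ξ
  simp only [← mul_assoc] at h2
  exact h2.symm

theorem lieGroup_minSmoothness : LieGroup 𝓘(ℝ, E) (minSmoothness ℝ 3) G := by
  refine LieGroup.of_le (n := ∞) ?_
  rw [minSmoothness_of_isRCLikeNormedField]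
  exact WithTop.coe_le_coe.2 (le_top : (3 : ℕ∞) ≤ ⊤)

theorem contMDiff_leftField (ξ : E) : ContMDiff 𝓘(ℝ, E) 𝓘(ℝ, E).tangent 1
    (fun g : G => (⟨g, leftField G ξ g⟩ : TangentBundle 𝓘(ℝ, E) G)) := by
  have := lieGroup_minSmoothness (E := E) (G := G)
  refine (contMDiff_mulInvariantVectorField (I := 𝓘(ℝ, E)) (G := G) ξ).of_le ?_
  rw [minSmoothness_of_isRCLikeNormedField]
  exact one_le_two

theorem isMIntegralCurveOn_mul_left {ξ : E} {c : ℝ → G} {s : Set ℝ}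
    (hc : IsMIntegralCurveOn (I := 𝓘(ℝ, E)) c (leftField G ξ) s) (g : G) :
    IsMIntegralCurveOn (I := 𝓘(ℝ, E)) (fun τ => g * c τ) (leftField G ξ) s := by
  intro τ hτ
  have h := (mdiff_mul_left g (c τ)).hasMFDerivAt.comp_hasMFDerivWithinAt τ (hc τ hτ)
  exact h.congr_mfderiv (comp_smulRight_one (E := E)
    (modelDeriv 𝓘(ℝ, E) 𝓘(ℝ, E) (fun x : G => g * x) (c τ)) (leftField_mul ξ g (c τ)))

variable [CompleteSpace E] [T2Space G]

theorem exists_isMIntegralCurve_leftField (ξ : E) :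
    ∃ c : ℝ → G, c 0 = 1 ∧ IsMIntegralCurve (I := 𝓘(ℝ, E)) c (leftField G ξ) := by
  have : IsManifold 𝓘(ℝ, E) ∞ G := LieGroup.toContMDiffMul.toIsManifold
  have : IsManifold 𝓘(ℝ, E) 1 G := IsManifold.of_le (n := ∞) (by simp)
  obtain ⟨c, hc, hc'⟩ := exists_isMIntegralCurveAt_of_contMDiffAt_boundaryless (t₀ := 0)
    (contMDiff_leftField (G := G) ξ 1)
  obtain ⟨ε, hε, h⟩ := isMIntegralCurveAt_iff'.1 hc'
  rw [Real.ball_eq_Ioo, zero_sub, zero_add] at h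
  -- Left translates of one local curve give a curve through every `g` on the same interval
  -- $(-\varepsilon,\varepsilon)$; such a uniform existence time forces completeness.
  refine exists_isMIntegralCurve_of_isMIntegralCurveOn (contMDiff_leftField ξ) hε
    (fun g => ⟨fun τ => g * c τ, ?_, isMIntegralCurveOn_mul_left h g⟩) 1
  simp [hc]

/-- The curve $\tau\mapsto c(s\tau)$ integrates the field of $s\xi$, so by uniqueness it is the
curve chosen in `lieExp`. -/
theorem lieExp_curve (ξ : E) : ∃ c : ℝ → G, c 0 = 1 ∧
    IsMIntegralCurve (I := 𝓘(ℝ, E)) c (leftField G ξ) ∧ ∀ s : ℝ, lieExp G (s • ξ) = c s := by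
  have : IsManifold 𝓘(ℝ, E) ∞ G := LieGroup.toContMDiffMul.toIsManifold
  have : IsManifold 𝓘(ℝ, E) 1 G := IsManifold.of_le (n := ∞) (by simp)
  obtain ⟨c, hc, hc'⟩ := exists_isMIntegralCurve_leftField (G := G) ξ
  refine ⟨c, hc, hc', fun s => ?_⟩
  have h1 := Classical.epsilon_spec (exists_isMIntegralCurve_leftField (G := G) (s • ξ))
  have h2 := hc'.comp_mul s
  have h3 : (s • fun g => leftField G ξ g) = leftField G (s • ξ) :=
    have := lieGroup_minSmoothness (E := E) (G := G)
    (mulInvariantVectorField_smul (I := 𝓘(ℝ, E)) (G := G) s ξ).symm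
  rw [h3] at h2
  have h4 := isMIntegralCurve_Ioo_eq_of_contMDiff_boundaryless (t₀ := 0)
    (contMDiff_leftField (s • ξ)) h1.2 h2 (by rw [h1.1]; simp [hc])
  have h5 : lieExp G (s • ξ) = c (1 * s) := congrFun h4 1
  rwa [one_mul] at h5

theorem IsLieLog.mdiff {lg : G → E} (hlg : IsLieLog lg) :
    MDifferentiableAt 𝓘(ℝ, E) 𝓘(ℝ, E) lg 1 :=
  hlg.contMDiffAt.mdifferentiableAt (by simp)

/-- Differentiate $\log(\exp(s\xi))=s\xi$ at $s=0$ along the integral curve. Working on one line at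
a time avoids any smoothness of the exponential map. -/
theorem IsLieLog.modelDeriv_one {lg : G → E} (hlg : IsLieLog lg) :
    modelDeriv 𝓘(ℝ, E) 𝓘(ℝ, E) lg 1 = ContinuousLinearMap.id ℝ E := by
  ext ξ
  obtain ⟨c, hc, hc', hexp⟩ := lieExp_curve (G := G) ξ
  have h1 : modelDeriv 𝓘(ℝ, ℝ) 𝓘(ℝ, E) c 0 1 = ξ := by
    have hv : leftField G ξ (c 0) = ξ := by
      rw [hc]
      exact leftField_one ξ
    have h : ∀ v : E, modelDeriv 𝓘(ℝ, ℝ) 𝓘(ℝ, E) c 0 = (1 : ℝ →L[ℝ] ℝ).smulRight v →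
        modelDeriv 𝓘(ℝ, ℝ) 𝓘(ℝ, E) c 0 1 = v := by
      intro v h
      rw [h]
      simp
    exact (h _ (hc' 0).mfderiv).trans hv
  have h2 := modelDeriv_comp hlg.mdiff (hc' 0).mdifferentiableAt hc
  have h3 : (fun s : ℝ => lg (c s)) =ᶠ[𝓝 0] fun s => s • ξ := by
    have ht : Filter.Tendsto (fun s : ℝ => s • ξ) (𝓝 0) (𝓝 0) := by
      have h : Continuous (fun s : ℝ => s • ξ) := by fun_prop
      simpa using h.tendsto 0
    filter_upwards [ht.eventually hlg.log_exp] with s hs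
    rw [← hexp, hs]
  have h4 : HasFDerivAt (fun s : ℝ => s • ξ) ((1 : ℝ →L[ℝ] ℝ).smulRight ξ) 0 :=
    (hasFDerivAt_id (0 : ℝ)).smul_const ξ
  rw [modelDeriv_congr h3, modelDeriv_eq_fderiv, h4.fderiv] at h2
  have h5 := DFunLike.congr_fun h2 1
  rw [ContinuousLinearMap.comp_apply, h1] at h5
  simpa using h5.symm

end Exponential

/-! ### Component matrices and the linear system for the brackets at the unit -/

section Matrices

open Matrix

variable {E : Type*} [NormedAddCommGroup E] [NormedSpace ℝ E] [FiniteDimensional ℝ E]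
  {G : Type*} [TopologicalSpace G] [ChartedSpace E G] [Group G]
  {ι : Type*} [Fintype ι] (t : Module.Basis ι ℝ E)

theorem dualVec_apply (i : ι) (v : E) : dualVec t i v = t.repr v i := rfl

theorem dualVec_basis [DecidableEq ι] (i j : ι) :
    dualVec t i (t j) = (1 : Matrix ι ι ℝ) i j := by
  rw [dualVec_apply, t.repr_self, Finsupp.single_apply, Matrix.one_apply]
  simp only [eq_comm]

theorem apply_expand (y : StrongDual ℝ E) (v : E) : y v = ∑ i, t.repr v i * y (t i) := by
  conv_lhs => rw [← t.sum_repr v]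
  simp only [map_sum, map_smul, smul_eq_mul]

theorem dual_expand (y : StrongDual ℝ E) : y = ∑ i, y (t i) • dualVec t i := by
  ext v
  simpa [dualVec_apply, mul_comm] using apply_expand t y v

/-- The matrix of an endomorphism of `𝔤^*`; row `i` is the image of `t^*_i`. -/
def dualMatrix (L : StrongDual ℝ E →L[ℝ] StrongDual ℝ E) : Matrix ι ι ℝ :=
  Matrix.of fun i j => L (dualVec t i) (t j)

/-- The product is reversed because rows, not columns, hold the images; this is the index convention
of `jac`. -/
theorem dualMatrix_comp (L K : StrongDual ℝ E →L[ℝ] StrongDual ℝ E) :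
    dualMatrix t (L.comp K) = dualMatrix t K * dualMatrix t L := by
  ext i j
  simp only [dualMatrix, Matrix.mul_apply, Matrix.of_apply, ContinuousLinearMap.comp_apply]
  conv_lhs => rw [dual_expand t (K (dualVec t i))]
  simp

theorem dualMatrix_id [DecidableEq ι] :
    dualMatrix t (ContinuousLinearMap.id ℝ (StrongDual ℝ E)) = 1 := by
  ext i j
  exact dualVec_basis t i j

theorem bilin_dualMatrix (B : StrongDual ℝ E →ₗ[ℝ] StrongDual ℝ E →ₗ[ℝ] ℝ)
    (L : StrongDual ℝ E →L[ℝ] StrongDual ℝ E) :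
    (Matrix.of fun i j => B (L (dualVec t i)) (L (dualVec t j))) =
      dualMatrix t L * (Matrix.of fun i j => B (dualVec t i) (dualVec t j)) *
        (dualMatrix t L)ᵀ := by
  ext i j
  simp only [dualMatrix, Matrix.mul_apply, Matrix.of_apply, Matrix.transpose_apply]
  conv_lhs => rw [dual_expand t (L (dualVec t i)), dual_expand t (L (dualVec t j))]
  simp only [map_sum, map_smul, LinearMap.sum_apply, LinearMap.smul_apply, smul_eq_mul,
    Finset.sum_mul, Finset.mul_sum]
  refine Finset.sum_congr rfl fun k _ => Finset.sum_congr rfl fun l _ => ?_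
  ring

theorem formMatrix_eq (F : DiffForm (modelX E) (StrongDual ℝ E) 2) (x : StrongDual ℝ E) :
    formMatrix t F x = Matrix.of fun i j => toBilin (formAt F x) (dualVec t i) (dualVec t j) := rfl

/-- A solution of `Φ (1 + Θ F) = F` is `(1 + F Θ)⁻¹ F`. -/
theorem isUnit_det_and_eq_of_add_mul [DecidableEq ι] {Φ F Θ : Matrix ι ι ℝ}
    (h : Φ + Φ * Θ * F = F) : IsUnit (1 + F * Θ).det ∧ Φ = (1 + F * Θ)⁻¹ * F := by
  -- The left inverse is built from the solution itself, so the existence of the bracket already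
  -- forces invertibility.
  have h1 : (1 - Φ * Θ) * (1 + F * Θ) = 1 := by
    have h2 : (1 - Φ * Θ) * (1 + F * Θ) = 1 + (F - (Φ + Φ * Θ * F)) * Θ := by noncomm_ring
    rw [h2, h, sub_self, Matrix.zero_mul, add_zero]
  refine ⟨Matrix.isUnit_det_of_left_inverse h1, ?_⟩
  rw [Matrix.inv_eq_left_inv h1, Matrix.sub_mul, Matrix.one_mul]
  exact eq_sub_of_add_eq h

variable [LieGroup 𝓘(ℝ, E) ∞ G]

theorem Theta_apply (x : StrongDual ℝ E) (a b : ι) :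
    Theta G t x a b = x (bracket E G (t a) (t b)) := by
  have : CompleteSpace E := FiniteDimensional.complete ℝ E
  have h : ∀ c, structConst G t a b c = t.repr (bracket E G (t a) (t b)) c := by
    intro c
    rw [structConst, mlieBracket_rightField]
  rw [apply_expand t, Theta, Matrix.of_apply]
  simp only [h]

theorem apply_bracket_expand (x : StrongDual ℝ E) (u v : E) :
    x (bracket E G u v) = ∑ i, ∑ j, t.repr u i * Theta G t x i j * t.repr v j := by
  simp only [Theta_apply]
  conv_lhs => rw [← t.sum_repr u, ← t.sum_repr v]
  simp only [map_sum, map_smul, _root_.sum_apply, _root_.smul_apply,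
    smul_eq_mul, Finset.mul_sum]
  rw [Finset.sum_comm]
  refine Finset.sum_congr rfl fun k _ => Finset.sum_congr rfl fun l _ => ?_
  ring

variable {t}

theorem mdiff_logCoord [T2Space G] {lg : G → E} (hlg : IsLieLog lg) {k : Gpd E G → G} {q : Gpd E G}
    (hk : MDifferentiableAt (modelGpd E) 𝓘(ℝ, E) k q) (hk1 : k q = 1) (a : ι) :
    MDifferentiableAt (modelGpd E) 𝓘(ℝ, ℝ) (fun q => t.repr (lg (k q)) a) q :=
  MDifferentiableAt.comp q (g := dualVec t a) (dualVec t a).differentiableAt.mdifferentiableAt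
    (MDifferentiableAt.comp_of_eq q hlg.mdiff hk hk1)

theorem modelDeriv_logCoord [T2Space G] {lg : G → E} (hlg : IsLieLog lg) {k : Gpd E G → G}
    {q : Gpd E G} (hk : MDifferentiableAt (modelGpd E) 𝓘(ℝ, E) k q) (hk1 : k q = 1) (a : ι)
    (v : StrongDual ℝ E × E) :
    modelDeriv (modelGpd E) 𝓘(ℝ, ℝ) (fun q => t.repr (lg (k q)) a) q v =
      t.repr (modelDeriv (modelGpd E) 𝓘(ℝ, E) k q v) a := by
  have : CompleteSpace E := FiniteDimensional.complete ℝ E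
  have h1 := modelDeriv_comp (g := dualVec t a) (f := fun q => lg (k q))
    (dualVec t a).differentiableAt.mdifferentiableAt
    (MDifferentiableAt.comp_of_eq q hlg.mdiff hk hk1) rfl
  rw [modelDeriv_comp hlg.mdiff hk hk1, hlg.modelDeriv_one, ContinuousLinearMap.id_comp,
    modelDeriv_eq_fderiv, ContinuousLinearMap.fderiv] at h1
  exact DFunLike.congr_fun h1 v

variable [T2Space G] {S : Bisection E G} {lg : G → E}

/-- The Hamiltonian equation for $\pi_a$ at $(y,1)$ is tested in the two factors. Group directions
give the $\mathfrak g^*$-component of the Hamiltonian vector as row $a$ of $\Phi\Theta-1$; base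
directions then give $\Phi+(\Phi\Theta-1)F^t=0$. -/
theorem FHat_equation [DecidableEq ι] (hlg : IsLieLog lg) (y : StrongDual ℝ E) :
    FHat t S lg y + FHat t S lg y * Theta G t y * formMatrix t S.Ft y = formMatrix t S.Ft y := by
  have hsnd : MDifferentiableAt (modelGpd E) 𝓘(ℝ, E) (fun q : Gpd E G => q.2) (y, (1 : G)) :=
    mdifferentiableAt_snd
  have hd := fun (a : ι) (v : StrongDual ℝ E × E) =>
    modelDeriv_logCoord (t := t) hlg hsnd rfl a v
  rw [modelDeriv_snd] at hd
  have hnd := S.nondegenerateAt_omegaH (y, (1 : G))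
  choose Z hZ using fun a : ι =>
    exists_hamiltonian hnd (fun q : Gpd E G => t.repr (lg q.2) a)
  -- Since $d\log$ is the identity at the unit, the brackets are the coordinates of the group
  -- component.
  have hΦ : ∀ a b, FHat t S lg y a b = t.repr (Z a).2 b := by
    intro a b
    rw [FHat, Matrix.of_apply, poissonBracket_eq hnd (Z a) (hZ a), hd]
    rfl
  have hZ' : ∀ a (w : StrongDual ℝ E × E),
      w.1 (Z a).2 - (Z a).1 w.2 + y (bracket E G (Z a).2 w.2) +
        toBilin (formAt S.Ft y) (Z a).1 w.1 = t.repr w.2 a := by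
    intro a w
    have h := hZ a w
    rw [hd, S.omegaH_eq, omegaFrame] at h
    simp only [rMC_one, ContinuousLinearMap.id_apply] at h
    exact h
  have hP : ∀ a c, (Z a).1 (t c) = (FHat t S lg y * Theta G t y - 1) a c := by
    intro a c
    have h := hZ' a (0, t c)
    have h1 := apply_expand t (y.comp ((bracket E G).flip (t c))) (Z a).2
    simp only [ContinuousLinearMap.comp_apply, ContinuousLinearMap.flip_apply, ← Theta_apply,
      ← hΦ] at h1
    rw [← Matrix.mul_apply] at h1
    have h2 : t.repr (t c) a = (1 : Matrix ι ι ℝ) a c := dualVec_basis t a c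
    rw [h1, h2] at h
    rw [Matrix.sub_apply]
    simp only [_root_.zero_apply, map_zero, add_zero] at h
    linarith
  ext a c
  have h := hZ' a (dualVec t c, 0)
  have h1 : toBilin (formAt S.Ft y) (Z a).1 (dualVec t c) =
      ((FHat t S lg y * Theta G t y - 1) * formMatrix t S.Ft y) a c := by
    rw [dual_expand t (Z a).1, Matrix.mul_apply]
    simp only [map_sum, map_smul, LinearMap.sum_apply, LinearMap.smul_apply, smul_eq_mul, hP]
    rfl
  simp only [h1, map_zero, Matrix.sub_mul, Matrix.one_mul, Matrix.sub_apply, dualVec_apply,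
    ← hΦ, sub_zero, add_zero, Finsupp.coe_zero, Pi.zero_apply] at h
  rw [Matrix.add_apply]
  linarith

end Matrices

/-! ### Gauge-invariant momenta on the bisection -/

section Brackets

variable {E : Type*} [NormedAddCommGroup E] [NormedSpace ℝ E] [FiniteDimensional ℝ E]
  {G : Type*} [TopologicalSpace G] [ChartedSpace E G] [Group G]
  {ι : Type*} [Fintype ι] [DecidableEq ι] {t : Module.Basis ι ℝ E} {S : Bisection E G}

theorem jac_eq (x : StrongDual ℝ E) : jac t S x = dualMatrix t (fderiv ℝ S.l x) := rfl

theorem jac_mul_dualMatrix (x : StrongDual ℝ E) :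
    jac t S x * dualMatrix t (fderiv ℝ S.r (S.l x)) = 1 := by
  rw [jac_eq, ← dualMatrix_comp, S.fderiv_r_comp_l, dualMatrix_id]

theorem isUnit_det_jac (x : StrongDual ℝ E) : IsUnit (jac t S x).det :=
  Matrix.isUnit_det_of_right_inverse (jac_mul_dualMatrix x)

theorem jac_inv (x : StrongDual ℝ E) :
    (jac t S x)⁻¹ = dualMatrix t (fderiv ℝ S.r (S.l x)) :=
  Matrix.inv_eq_right_inv (jac_mul_dualMatrix x)

/-- The section $\Sigma_t$ is $\Sigma_s\circ r_\Sigma$, and the matrix of $dr_\Sigma$ at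
$l_\Sigma(x)$ is $\bar J$. -/
theorem formMatrix_Ft (x : StrongDual ℝ E) : formMatrix t S.Ft (S.l x) = FsBar t S x := by
  have h1 : modelDeriv (modelX E) (modelGpd E) S.secT (S.l x) =
      (modelDeriv (modelX E) (modelGpd E) S.sec x).comp (fderiv ℝ S.r (S.l x)) := by
    rw [← modelDeriv_eq_fderiv]
    exact modelDeriv_comp (S.contMDiff_sec.mdifferentiable (by simp) x)
      (S.differentiable_r _).mdifferentiableAt (S.r_l x)
  have h2 : ∀ v w : StrongDual ℝ E, toBilin (formAt S.Ft (S.l x)) v w =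
      toBilin (formAt S.Fs x) (fderiv ℝ S.r (S.l x) v) (fderiv ℝ S.r (S.l x) w) := by
    intro v w
    rw [toBilin_apply, toBilin_apply, Bisection.Ft, Bisection.Fs, pullback_eq, pullback_eq, h1,
      Bisection.secT, S.r_l]
    rfl
  rw [FsBar, jac_inv, formMatrix_eq, formMatrix_eq]
  simp only [h2]
  exact bilin_dualMatrix t _ _

variable [LieGroup 𝓘(ℝ, E) ∞ G]

theorem mdiff_gaugeInvariant (q : Gpd E G) :
    MDifferentiableAt (modelGpd E) 𝓘(ℝ, E) (fun q : Gpd E G => (S.val q.1)⁻¹ * q.2) q :=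
  mdiff_mul (mdiff_inv (MDifferentiableAt.comp q (g := S.val) (I' := modelX E) (S.mdiff_val q.1)
    mdifferentiableAt_fst)) mdifferentiableAt_snd

variable [T2Space G] {lg : G → E}

/-- Brackets are natural under $R_\Sigma$, which sends $(l_\Sigma(x),1)$ to $\Sigma_s(x)$ and
satisfies $\pi_a\circ R_\Sigma=\pi_a(h)$. -/
theorem momentumBracket_eq_FHat (hlg : IsLieLog lg) (x : StrongDual ℝ E) :
    momentumBracket t S lg x = FHat t S lg (S.l x) := by
  ext a b
  have hR : S.R (S.l x, 1) = S.sec x := by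
    rw [S.R_eq, S.sec_eq, mul_one, Bisection.valT, S.r_l]
  have hm : ∀ a, MDifferentiableAt (modelGpd E) 𝓘(ℝ, ℝ) (momentum t S lg a) (S.R (S.l x, 1)) := by
    intro a
    rw [hR]
    exact mdiff_logCoord hlg (mdiff_gaugeInvariant _) (by rw [S.sec_eq, inv_mul_cancel]) a
  have hc : ∀ (a : ι) (q : Gpd E G), momentum t S lg a (S.R q) = t.repr (lg q.2) a := by
    intro a q
    rw [momentum, S.R_eq, Bisection.valT, inv_mul_cancel_left]
  have h := poissonBracket_pullback (nondegenerateAt_omega _) (S.mdiff_R (S.l x, 1))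
    (S.bijective_modelDeriv_R _) (hm a) (hm b)
  rw [hR] at h
  simp only [hc] at h
  exact h.symm

/-- The derivative of the gauge-invariant momenta on the bisection. -/
theorem modelDeriv_momentum (hlg : IsLieLog lg) (x : StrongDual ℝ E) (a : ι)
    (v : StrongDual ℝ E × E) :
    modelDeriv (modelGpd E) 𝓘(ℝ, ℝ) (momentum t S lg a) (S.sec x) v =
      t.repr ((Ad (S.val x)⁻¹ : E →L[ℝ] E) (rMC (S.val x) v.2 -
        rMC (S.val x) (modelDeriv (modelX E) 𝓘(ℝ, E) S.val x v.1))) a := by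
  rw [S.sec_eq]
  have hval : MDifferentiableAt (modelGpd E) 𝓘(ℝ, E) (fun q : Gpd E G => S.val q.1)
      (x, S.val x) :=
    MDifferentiableAt.comp (x, S.val x) (g := S.val) (I' := modelX E) (S.mdiff_val x)
      mdifferentiableAt_fst
  have hk := mdiff_gaugeInvariant (S := S) (x, S.val x)
  have h1 : modelDeriv (modelGpd E) 𝓘(ℝ, ℝ) (momentum t S lg a) (x, S.val x) v =
      t.repr (modelDeriv (modelGpd E) 𝓘(ℝ, E) (fun q : Gpd E G => (S.val q.1)⁻¹ * q.2)
        (x, S.val x) v) a :=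
    modelDeriv_logCoord hlg hk (inv_mul_cancel _) a v
  have h2 := rMC_modelDeriv_mul hval hk v
  have h3 := modelDeriv_comp (I := modelGpd E) (f := fun q : Gpd E G => q.1) (p := (x, S.val x))
    (S.mdiff_val x) mdifferentiableAt_fst rfl
  simp only [mul_inv_cancel_left, inv_mul_cancel, mul_one, rMC_one,
    ContinuousLinearMap.id_apply] at h2
  rw [modelDeriv_snd, h3, modelDeriv_fst] at h2
  rw [h1, ← Ad_inv_apply (S.val x) (modelDeriv (modelGpd E) 𝓘(ℝ, E)
    (fun q : Gpd E G => (S.val q.1)⁻¹ * q.2) (x, S.val x) v)]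
  congr 2
  congr 1
  exact eq_sub_of_add_eq' h2.symm

theorem modelDeriv_val {A : StrongDual ℝ E → E} (hA : ContDiff ℝ ∞ A)
    (hval : ∀ x, S.val x = lieExp G (A x)) (x : StrongDual ℝ E)
    (hx : IsUnit (gammaBar G t (A x)).det) :
    modelDeriv (modelX E) 𝓘(ℝ, E) S.val x =
      (modelDeriv 𝓘(ℝ, E) 𝓘(ℝ, E) (lieExp G) (A x)).comp (fderiv ℝ A x) := by
  -- Differentiability of the exponential at $A(x)$ comes from the regularity hypothesis: otherwise
  -- its `mfderiv` is the default value 0, so $\bar\gamma$ vanishes and is singular unless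
  -- $\mathfrak g=0$, where the claim is trivial.
  by_cases hd : MDifferentiableAt 𝓘(ℝ, E) 𝓘(ℝ, E) (lieExp G) (A x)
  · have h : S.val = fun x => lieExp G (A x) := funext hval
    rw [h, ← modelDeriv_eq_fderiv]
    exact modelDeriv_comp hd ((hA.differentiable (by simp)) x).mdifferentiableAt rfl
  · rcases isEmpty_or_nonempty ι with hι | hι
    · have hE : ∀ v : E, v = 0 := fun v => by
        rw [← t.sum_repr v]
        simp
      ext v
      rw [hE (modelDeriv (modelX E) 𝓘(ℝ, E) S.val x v), hE (ContinuousLinearMap.comp _ _ v)]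
    · exfalso
      have h0 : modelDeriv 𝓘(ℝ, E) 𝓘(ℝ, E) (lieExp G) (A x) = 0 :=
        mfderiv_zero_of_not_mdifferentiableAt hd
      have h1 : gammaBar G t (A x) = 0 := by
        ext i a
        have h : gammaBar G t (A x) i a = t.repr (rMC (lieExp G (A x))
          (modelDeriv 𝓘(ℝ, E) 𝓘(ℝ, E) (lieExp G) (A x) (t i))) a := rfl
        rw [h, h0]
        simp
      rw [h1, Matrix.det_zero] at hx
      exact not_isUnit_zero hx

/-- With $C$ the matrix of $\mathrm{Ad}_{g^{-1}}$ at $g=\mathcal A(x)$ and $K=(\partial A)\rho$,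
both sides equal $C^TK-K^TC+K^T\Theta K$. The left side reduces to this because $\rho=\bar\gamma C$,
hence $\gamma\rho=C$; the right side by solving for the Hamiltonian vectors. -/
theorem FCal_eq_momentumBracket (hlg : IsLieLog lg) {A : StrongDual ℝ E → E}
    (hA : ContDiff ℝ ∞ A) (hval : ∀ x, S.val x = lieExp G (A x)) (x : StrongDual ℝ E)
    (hx : IsUnit (gammaBar G t (A x)).det) : FCal G t A x = momentumBracket t S lg x := by
  set N : E →L[ℝ] E := (rMC (lieExp G (A x))).comp
    (modelDeriv 𝓘(ℝ, E) 𝓘(ℝ, E) (lieExp G) (A x)) with hN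
  set L : E →L[ℝ] E := Ad (lieExp G (A x))⁻¹ with hL
  set C : Matrix ι ι ℝ := Matrix.of fun l a => t.repr (L (t l)) a with hC
  have hgb : ∀ i a, gammaBar G t (A x) i a = t.repr (N (t i)) a := fun _ _ => rfl
  have hrho : ∀ m a, rho G t (A x) m a = t.repr (L (N (t m))) a := by
    intro m a
    rw [rho, Matrix.of_apply, leftMC_eq]
    rfl
  have hLexp : ∀ v a, t.repr (L v) a = ∑ l, t.repr v l * C l a := by
    intro v a
    exact apply_expand t ((dualVec t a).comp L) v
  have hrhoC : rho G t (A x) = gammaBar G t (A x) * C := by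
    ext m a
    rw [hrho, hLexp, Matrix.mul_apply]
    rfl
  have hCrho : gamma G t (A x) * rho G t (A x) = C := by
    rw [hrhoC, gamma, Matrix.nonsing_inv_mul_cancel_left _ _ hx]
  set K : Matrix ι ι ℝ := dA t A x * rho G t (A x) with hK
  have hFCal : FCal G t A x = C.transpose * K - K.transpose * C +
      K.transpose * Theta G t x * K := by
    have h : FNaive G t A x = (gamma G t (A x)).transpose * dA t A x -
        (dA t A x).transpose * gamma G t (A x) +
        (dA t A x).transpose * Theta G t x * dA t A x := by
      ext m n
      simp only [FNaive, Matrix.of_apply, Matrix.add_apply, Matrix.sub_apply, Matrix.mul_apply,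
        Matrix.transpose_apply, Finset.sum_mul]
      congr 1
      · congr 1
        exact Finset.sum_congr rfl fun l _ => mul_comm _ _
      · rw [Finset.sum_comm]
        refine Finset.sum_congr rfl fun i _ => Finset.sum_congr rfl fun j _ => ?_
        ring
    rw [FCal, h, ← hCrho, hK]
    simp only [Matrix.transpose_mul, Matrix.mul_add, Matrix.add_mul, Matrix.mul_sub,
      Matrix.sub_mul, Matrix.mul_assoc]
  have hKapp : ∀ i a, t.repr (L (N (fderiv ℝ A x (dualVec t i)))) a = K i a := by
    intro i a
    rw [hK, Matrix.mul_apply]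
    have h := apply_expand t ((dualVec t a).comp (L.comp N)) (fderiv ℝ A x (dualVec t i))
    simp only [ContinuousLinearMap.comp_apply, dualVec_apply, ← hrho] at h
    exact h
  have hd : ∀ a (v : StrongDual ℝ E × E),
      modelDeriv (modelGpd E) 𝓘(ℝ, ℝ) (momentum t S lg a) (S.sec x) v =
        t.repr (L (rMC (S.val x) v.2)) a - t.repr (L (N (fderiv ℝ A x v.1))) a := by
    intro a v
    rw [modelDeriv_momentum hlg, modelDeriv_val hA hval x hx, map_sub, map_sub, Finsupp.sub_apply,
      hval x]
    rfl
  -- Right-trivialized group component of the Hamiltonian vector of $\pi_a$, forced by testing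
  -- $\omega$ against base directions.
  set U : ι → E := fun a => -∑ i, K i a • t i with hU
  have hUrepr : ∀ a i, t.repr (U a) i = -K i a := by
    intro a i
    simp [hU, Finsupp.single_apply]
  have hUapp : ∀ a (w : StrongDual ℝ E), w (U a) = -t.repr (L (N (fderiv ℝ A x w))) a := by
    intro a w
    rw [apply_expand t w (U a)]
    have h : t.repr (L (N (fderiv ℝ A x w))) a = ∑ i, w (t i) * K i a := by
      conv_lhs => rw [dual_expand t w]
      simp [hKapp]
    rw [h, ← Finset.sum_neg_distrib]
    refine Finset.sum_congr rfl fun i _ => ?_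
    rw [hUrepr]
    ring
  choose V hV using fun a => (rMC_bijective (S.val x)).2 (U a)
  ext a b
  -- The $\mathfrak g^*$-component, forced in the same way by the group directions.
  set P : StrongDual ℝ E := x.comp (bracket E G (U a)) - (dualVec t a).comp L with hP
  have hham : ∀ w : StrongDual ℝ E × E, formAt omega (S.sec x) ![(P, V a), w] =
      modelDeriv (modelGpd E) 𝓘(ℝ, ℝ) (momentum t S lg a) (S.sec x) w := by
    intro w
    rw [hd, omega_eq, S.sec_eq]
    simp only [hV, hUapp, hP, sub_apply, ContinuousLinearMap.comp_apply, dualVec_apply]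
    ring
  -- Turns the base part of $d\pi_b$ at the Hamiltonian vector into $P(U_b)$, so the bracket is
  -- $(LU_a)_b-(LU_b)_a+x([U_a,U_b])$.
  have hPU := hUapp b P
  rw [momentumBracket, Matrix.of_apply, poissonBracket_eq (nondegenerateAt_omega _) _ hham, hd,
    sub_eq_add_neg, ← hPU, hFCal, hP]
  simp only [hV, sub_apply, ContinuousLinearMap.comp_apply, dualVec_apply]
  rw [apply_bracket_expand t, hLexp, hLexp]
  simp only [hUrepr, Matrix.add_apply, Matrix.sub_apply, Matrix.mul_apply, Matrix.transpose_apply,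
    Finset.sum_mul]
  rw [Finset.sum_comm]
  simp only [neg_mul, Finset.sum_neg_distrib, mul_neg, neg_neg]
  have h1 : ∑ l, C l a * K l b = ∑ l, K l b * C l a :=
    Finset.sum_congr rfl fun l _ => mul_comm _ _
  rw [h1]
  ring

end Brackets

end PoissonGauge

end

theorem mainTheorem6
    {E : Type*} [NormedAddCommGroup E] [NormedSpace ℝ E] [FiniteDimensional ℝ E]
    {G : Type*} [TopologicalSpace G] [T2Space G] [ChartedSpace E G] [Group G]
    [LieGroup 𝓘(ℝ, E) ∞ G]
    {ι : Type*} [Fintype ι] [DecidableEq ι] (t : Module.Basis ι ℝ E)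
    (S : Bisection E G) (lg : G → E) (hlg : IsLieLog lg) :
    -- the forms `ω` and `ω_h` are nondegenerate, and `ω_h = -d⟨y, dh h⁻¹⟩ + F^t`
    (∀ q : Gpd E G, NondegenerateAt (modelGpd E) omega q) ∧
    (∀ q : Gpd E G, NondegenerateAt (modelGpd E) S.omegaH q) ∧
    (∀ q : Gpd E G, S.omegaH q =
      -(extD (modelGpd E) liouville q) + pullback (modelGpd E) (modelX E) source S.Ft q) ∧
    -- `𝓕̂ = (I + F^t Θ)⁻¹ F^t`
    (∀ y : StrongDual ℝ E,
      IsUnit (1 + formMatrix t S.Ft y * Theta G t y).det ∧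
      FHat t S lg y = (1 + formMatrix t S.Ft y * Theta G t y)⁻¹ * formMatrix t S.Ft y) ∧
    -- the bracket of the gauge-invariant momenta on the bisection, in terms of `𝓕̂` and of `F^s`
    (∀ x : StrongDual ℝ E,
      IsUnit (jac t S x).det ∧
      IsUnit (1 + FsBar t S x * Theta G t (S.l x)).det ∧
      momentumBracket t S lg x = FHat t S lg (S.l x) ∧
      momentumBracket t S lg x = (1 + FsBar t S x * Theta G t (S.l x))⁻¹ * FsBar t S x) ∧
    -- `𝓕 = ρ^T F ρ` for a bisection `𝒜 = exp A`, where `exp` is regular at `A(x)`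
    (∀ A : StrongDual ℝ E → E, ContDiff ℝ ∞ A → (∀ x, S.val x = lieExp G (A x)) →
      ∀ x : StrongDual ℝ E, IsUnit (gammaBar G t (A x)).det →
        FCal G t A x = momentumBracket t S lg x ∧
        FCal G t A x = FHat t S lg (S.l x) ∧
        FCal G t A x = (1 + FsBar t S x * Theta G t (S.l x))⁻¹ * FsBar t S x) := by
  refine ⟨nondegenerateAt_omega, S.nondegenerateAt_omegaH, S.omegaH_decomp,
    fun y => isUnit_det_and_eq_of_add_mul (FHat_equation hlg y), fun x => ?_,
    fun A hA hval x hx => ?_⟩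
  all_goals
    have h := isUnit_det_and_eq_of_add_mul (FHat_equation (t := t) (S := S) hlg (S.l x))
    rw [formMatrix_Ft] at h
    have hm := momentumBracket_eq_FHat (t := t) (S := S) hlg x
  · exact ⟨isUnit_det_jac x, h.1, hm, hm.trans h.2⟩
  · have e := FCal_eq_momentumBracket hlg hA hval x hx
    exact ⟨e, e.trans hm, (e.trans hm).trans h.2⟩
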